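/- Let $d\ge 2$. In the divisible sandpile on $\mathbb{Z}^d$, each site carries a nonnegative real mass. A site is full if its mass is at least $1$; toppling a full site means that it keeps mass $1$ and distributes the excess equally among its $2d$ nearest neighbors. At each time step one site is chosen and toppled (nothing happens if it is not full). For $m\ge 0$ start from mass $m$ at the origin and mass $0$ elsewhere. For every choice of the sequence of sites such that every site that is full at some time is toppled at that time or later, the mass converges pointwise to a limiting distribution $\nu_m:\mathbb{Z}^d\to\mathbb{R}$ with $\nu_m\le 1$, which does not depend on the sequence. Let $D_m=\{x\in\mathbb{Z}^d : \nu_m(x)=1\}$ be the set of fully occupied sites. For $\rho\in\mathbb{R}$ let $B_\rho=\{x\in\mathbb{Z}^d : |x|<\rho\}$, where $|\cdot|$ is the Euclidean norm (so $B_\rho=\emptyset$ if $\rho\le 0$), and let $\omega_d$ be the volume of the unit ball in $\mathbb{R}^d$. Then there are real constants $c,c'$ depending only on $d$ such that for all $m\ge 0$ $$B_{r-c}\subset D_m\subset B_{r+c'},\qquad r=(m/\omega_d)^{1/d}.$$ -/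

import Mathlib

open Filter Topology MeasureTheory

noncomputable section

namespace DivisibleSandpile

/-- The integer lattice `ℤ^d`. -/
abbrev Lattice (d : ℕ) : Type := Fin d → ℤ

/-- The Euclidean norm `|x| = (x₁² + ⋯ + x_d²)^{1/2}` of a lattice point. -/
def euclNorm {d : ℕ} (x : Lattice d) : ℝ := Real.sqrt (∑ i, (x i : ℝ) ^ 2)

/-- The open lattice ball `B_ρ = {x ∈ ℤ^d : |x| < ρ}` (empty when `ρ ≤ 0`). -/
def latticeBall (d : ℕ) (ρ : ℝ) : Set (Lattice d) := {x | euclNorm x < ρ}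

/-- Nearest-neighbour adjacency in `ℤ^d`: the `ℓ¹` distance is `1`. Each site has `2d` neighbours. -/
def Adj {d : ℕ} (x y : Lattice d) : Prop := ∑ i, |x i - y i| = 1

instance {d : ℕ} (x y : Lattice d) : Decidable (Adj x y) :=
  inferInstanceAs (Decidable (∑ i, |x i - y i| = 1))

/-- The volume `ω_d` of the unit ball of `ℝ^d`. -/
def unitBallVolume (d : ℕ) : ℝ :=
  (volume (Metric.ball (0 : EuclideanSpace ℝ (Fin d)) 1)).toReal

/-- Toppling the site `x` in the mass configuration `η`: if `η x ≥ 1`, the site `x` keeps mass `1`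
and its excess mass `η x - 1` is distributed equally among its `2d` neighbours.  If `η x ≤ 1`,
nothing happens (so a step at a site that is not full is an idle step). -/
def topple {d : ℕ} (x : Lattice d) (η : Lattice d → ℝ) : Lattice d → ℝ := fun y =>
  if y = x then min (η x) 1
  else if Adj x y then η y + max (η x - 1) 0 / (2 * d)
  else η y

/-- The mass configuration after `n` steps, starting from `σ` and toppling the site `T k` at
the `k`-th step (`k = 0, 1, 2, …`). -/
def massAt {d : ℕ} (σ : Lattice d → ℝ) (T : ℕ → Lattice d) : ℕ → Lattice d → ℝ
  | 0 => σ
  | n + 1 => topple (T n) (massAt σ T n)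

/-- Every full site (mass at least `1`) is eventually toppled: whenever a site is full after
`n` steps, it is toppled at some later step. -/
def EveryFullSiteToppled {d : ℕ} (σ : Lattice d → ℝ) (T : ℕ → Lattice d) : Prop :=
  ∀ n x, 1 ≤ massAt σ T n x → ∃ k, n ≤ k ∧ T k = x

/-- `ν` is the limiting mass distribution of the divisible sandpile started from `σ`: each site has
mass at most `1` in `ν`, and for every choice of the toppling sequence in which each full site is
eventually toppled, the mass converges to `ν`.
Such sequences exist (`exists_everyFullSiteToppled`), so `ν` is determined by `σ`. -/
def IsLimitingMass {d : ℕ} (σ ν : Lattice d → ℝ) : Prop :=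
  (∀ x, ν x ≤ 1) ∧
  ∀ T : ℕ → Lattice d, EveryFullSiteToppled σ T →
    ∀ x, Tendsto (fun n => massAt σ T n x) atTop (𝓝 (ν x))

/-- The pile of mass `m` at the origin. -/
def pointMass (d : ℕ) (m : ℝ) : Lattice d → ℝ := fun x => if x = 0 then m else 0

/-- The set of fully occupied sites of a limiting mass distribution. -/
def fullyOccupied {d : ℕ} (ν : Lattice d → ℝ) : Set (Lattice d) := {x | ν x = 1}

theorem exists_everyFullSiteToppled {d : ℕ} (σ : Lattice d → ℝ) :
    ∃ T : ℕ → Lattice d, EveryFullSiteToppled σ T := by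
  obtain ⟨f, hf⟩ := exists_surjective_nat (Lattice d)
  refine ⟨fun n => f (Nat.unpair n).1, fun n x _ => ?_⟩
  obtain ⟨j, hj⟩ := hf x
  exact ⟨Nat.pair j n, Nat.right_le_pair j n, by simp [hj]⟩

theorem IsLimitingMass.unique {d : ℕ} {σ ν ν' : Lattice d → ℝ}
    (h : IsLimitingMass σ ν) (h' : IsLimitingMass σ ν') : ν = ν' := by
  obtain ⟨T, hT⟩ := exists_everyFullSiteToppled σ
  funext x
  exact tendsto_nhds_unique (h.2 T hT x) (h'.2 T hT x)

end DivisibleSandpile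

end

/-! Let `u` be the limit of the odometers, i.e. the total mass emitted from each site. The mass at
any time is the initial mass σ plus the discrete Laplacian Δ of the odometer (`massAt_eq`). Hence σ
+ Δu ≤ 1, with equality where u > 0, and `u` is the least nonnegative function with σ + Δu ≤ 1
(`odometer_le`). One supersolution therefore yields convergence and independence of the toppling
order (`exists_odometer_limit`).

With g the lattice Green function and M = ω_d ρ^d, the function |x|² + M g(x) has Laplacian 1 - M
δ₀. Since g is radial up to O(|x|^{-d}) (`exists_green_sub_potential_le`), and M times this error is
O(1) at |x| ≈ ρ, subtracting a constant gives an obstacle H (`exists_obstacle`): at least -C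
everywhere, at most C on a layer just outside the sphere of radius ρ, and above C beyond a fixed
depth inside it. Thus H + C is a supersolution.

Inner bound: u - H is superharmonic in the ball and at least -C on its boundary, so u ≥ H - C > 0
well inside, and those sites are full.

Outer bound: u ≤ H + C ≤ 2C on the layer, and the maximum principle, applied to finite-time
odometers, extends u ≤ 2C to the whole exterior. Around a full site x₀ the function u must grow
quadratically, because u - |y - x₀|² is subharmonic wherever it is nonnegative. Far outside the ball
this contradicts u ≤ 2C.

The estimate for g comes from integrating a local central limit theorem in time. Its exponential
off-diagonal decay is obtained by shifting the Fourier contour to height t^{-1/2}. -/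

noncomputable section

namespace DivisibleSandpile

/-! ### Neighbours and the discrete Laplacian. -/

/-- The `i`-th unit vector of the lattice. -/
def unitVec {d : ℕ} (i : Fin d) : Lattice d := Pi.single i 1

/-- The sum of `f` over the `2d` neighbours of `x`. -/
def nbrSum {d : ℕ} (f : Lattice d → ℝ) (x : Lattice d) : ℝ :=
  ∑ i, (f (x + unitVec i) + f (x - unitVec i))

/-- The discrete Laplacian: the average over the neighbours minus the value. -/
def lap {d : ℕ} (f : Lattice d → ℝ) (x : Lattice d) : ℝ :=
  nbrSum f x / (2 * d) - f x

variable {d : ℕ}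

theorem lap_add (f g : Lattice d → ℝ) (x : Lattice d) :
    lap (fun y => f y + g y) x = lap f x + lap g x := by
  have : nbrSum (fun y => f y + g y) x = nbrSum f x + nbrSum g x := by
    simp only [nbrSum, ← Finset.sum_add_distrib]
    exact Finset.sum_congr rfl fun i _ => by ring
  simp only [lap, this]; ring

theorem lap_const_mul (a : ℝ) (f : Lattice d → ℝ) (x : Lattice d) :
    lap (fun y => a * f y) x = a * lap f x := by
  have : nbrSum (fun y => a * f y) x = a * nbrSum f x := by
    simp only [nbrSum, Finset.mul_sum]
    exact Finset.sum_congr rfl fun i _ => by ring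
  simp only [lap, this]; ring

theorem lap_const (hd : 0 < d) (a : ℝ) (x : Lattice d) : lap (fun _ => a) x = 0 := by
  have : (d : ℝ) ≠ 0 := by positivity
  simp only [lap, nbrSum, Finset.sum_const, Finset.card_univ, Fintype.card_fin, nsmul_eq_mul]
  field_simp; ring

theorem lap_sub (f g : Lattice d → ℝ) (x : Lattice d) :
    lap (fun y => f y - g y) x = lap f x - lap g x := by
  have h := lap_add f (fun y => (-1) * g y) x
  rw [lap_const_mul] at h
  simp only [sub_eq_add_neg, neg_one_mul] at h ⊢
  exact h

theorem Adj.symm {x y : Lattice d} (h : Adj x y) : Adj y x := by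
  unfold Adj at *
  rw [← h]
  exact Finset.sum_congr rfl fun i _ => abs_sub_comm _ _

theorem adj_add_unitVec (x : Lattice d) (i : Fin d) : Adj x (x + unitVec i) := by
  unfold Adj
  rw [Finset.sum_eq_single i]
  · simp [unitVec]
  · intro j _ hj; simp [unitVec, hj]
  · simp

theorem adj_sub_unitVec (x : Lattice d) (i : Fin d) : Adj x (x - unitVec i) := by
  have := (adj_add_unitVec (x - unitVec i) i).symm
  rwa [sub_add_cancel] at this

theorem Adj.exists_unitVec {x y : Lattice d} (h : Adj x y) :
    ∃ i, y = x + unitVec i ∨ y = x - unitVec i := by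
  unfold Adj at h
  have hex : ∃ i, x i - y i ≠ 0 := by
    by_contra! hc
    simp [hc] at h
  obtain ⟨i, hi⟩ := hex
  have h1 : |x i - y i| ≤ 1 := by
    rw [← h]
    exact Finset.single_le_sum (f := fun i => |x i - y i|) (fun j _ => abs_nonneg _)
      (Finset.mem_univ i)
  have h1' : |x i - y i| = 1 := le_antisymm h1 (Int.one_le_abs hi)
  have h2 : ∀ j, j ≠ i → x j - y j = 0 := by
    intro j hj
    have h3 : |x i - y i| + |x j - y j| ≤ 1 := by
      rw [← h, ← Finset.sum_pair (f := fun k => |x k - y k|) hj.symm]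
      exact Finset.sum_le_sum_of_subset_of_nonneg (Finset.subset_univ _)
        fun _ _ _ => abs_nonneg _
    have := abs_nonneg (x j - y j)
    exact abs_eq_zero.1 (by omega)
  refine ⟨i, ?_⟩
  rcases (abs_eq (by norm_num)).1 h1' with h4 | h4
  · right; funext j
    by_cases hj : j = i
    · subst hj; simp [unitVec]; omega
    · have := h2 j hj; simp [unitVec, hj]; omega
  · left; funext j
    by_cases hj : j = i
    · subst hj; simp [unitVec]; omega
    · have := h2 j hj; simp [unitVec, hj]; omega

theorem unitVec_inj {i j : Fin d} (h : (unitVec i : Lattice d) = unitVec j) : i = j := by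
  by_contra hij
  have := congrFun h i
  simp [unitVec, hij] at this

theorem unitVec_ne_neg (i j : Fin d) : (unitVec i : Lattice d) ≠ -unitVec j := by
  intro h
  have := congrFun h i
  by_cases hij : i = j
  · subst hij; simp [unitVec] at this
  · simp [unitVec, hij] at this

theorem not_adj_self (x : Lattice d) : ¬ Adj x x := by simp [Adj]

/-- The vectors ±`unitVec i` are pairwise distinct, so each neighbour is counted exactly once. This
links toppling, phrased with `Adj`, to the Laplacian. -/
theorem nbrSum_indicator (x : Lattice d) (a : ℝ) (y : Lattice d) :
    nbrSum (fun z => if z = x then a else 0) y = if Adj x y then a else 0 := by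
  unfold nbrSum
  split_ifs with h
  · obtain ⟨i, hi⟩ := h.exists_unitVec
    rw [Finset.sum_eq_single i]
    · rcases hi with rfl | rfl
      · have : ¬ (x + unitVec i + unitVec i = x) := by
          intro h
          exact unitVec_ne_neg i i (eq_neg_of_add_eq_zero_left (by simpa [add_assoc] using h))
        simp [this]
      · have : ¬ (x - unitVec i - unitVec i = x) := by
          intro h
          refine unitVec_ne_neg i i (eq_neg_of_add_eq_zero_left ?_)
          rw [sub_sub] at h
          simpa using h
        simp [this]
    · intro j _ hj
      have h1 : ¬ (y + unitVec j = x) := by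
        rcases hi with rfl | rfl
        · intro h
          refine unitVec_ne_neg i j (eq_neg_of_add_eq_zero_left ?_)
          simpa [add_assoc] using h
        · intro h
          refine hj (unitVec_inj ?_)
          have h2 : x + (unitVec j - unitVec i) = x + 0 := by
            rw [add_zero]; nth_rw 2 [← h]; abel
          exact sub_eq_zero.1 (add_left_cancel h2)
      have h2 : ¬ (y - unitVec j = x) := by
        rcases hi with rfl | rfl
        · intro h
          refine hj (unitVec_inj ?_)
          have h2 : x + (unitVec i - unitVec j) = x + 0 := by
            rw [add_zero]; nth_rw 2 [← h]; abel
          exact (sub_eq_zero.1 (add_left_cancel h2)).symm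
        · intro h
          refine unitVec_ne_neg i j (eq_neg_of_add_eq_zero_left ?_)
          have h2 : x - (unitVec i + unitVec j) = x - 0 := by
            rw [sub_zero]; nth_rw 2 [← h]; abel
          exact sub_right_injective h2
      simp [h1, h2]
    · simp
  · refine Finset.sum_eq_zero fun i _ => ?_
    have h1 : ¬ (y + unitVec i = x) := fun e => h (e ▸ (adj_add_unitVec y i).symm)
    have h2 : ¬ (y - unitVec i = x) := fun e => h (e ▸ (adj_sub_unitVec y i).symm)
    simp [h1, h2]

/-! ### Maximum principles on finite sets. -/

/-- Strong form of the maximum principle: `v` only has to be subharmonic where it is `≥ M`. -/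
theorem lt_of_subharmonic (hd : 0 < d) {S : Set (Lattice d)} (hS : S.Finite)
    {v : Lattice d → ℝ} {M : ℝ} (h1 : ∀ x ∈ S, M ≤ v x → 0 ≤ lap v x)
    (h2 : ∀ x ∈ S, ∀ y ∉ S, Adj x y → v y < M) : ∀ x ∈ S, v x < M := by
  by_contra! hc
  obtain ⟨x₀, hx₀, hM⟩ := hc
  obtain ⟨x₁, hx₁, hmax⟩ := S.exists_max_image v hS ⟨x₀, hx₀⟩
  -- Among the maximizers in `S`, take one with the largest first coordinate. Its neighbour in that
  -- direction has a strictly smaller value, contradicting the mean value inequality; no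
  -- connectedness of `S` is needed.
  let i₀ : Fin d := ⟨0, hd⟩
  obtain ⟨x, ⟨hxS, hxv⟩, hx⟩ := Set.exists_max_image {x ∈ S | v x = v x₁} (fun x => x i₀)
    (hS.subset fun x hx => hx.1) ⟨x₁, hx₁, rfl⟩
  have hMx : M ≤ v x := by rw [hxv]; exact hM.trans (hmax _ hx₀)
  have hnb : ∀ y, Adj x y → v y ≤ v x := by
    intro y hy
    by_cases hyS : y ∈ S
    · rw [hxv]; exact hmax _ hyS
    · exact (h2 x hxS y hyS hy).le.trans hMx
  have hlap := h1 x hxS hMx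
  have hd' : (0 : ℝ) < 2 * d := by positivity
  have hsum : v x * (2 * d) ≤ nbrSum v x := by
    unfold lap at hlap
    exact (le_div_iff₀ hd').1 (by linarith)
  have hlt : v (x + unitVec i₀) < v x := by
    refine lt_of_le_of_ne (hnb _ (adj_add_unitVec x i₀)) fun he => ?_
    have hmem : x + unitVec i₀ ∈ S := by
      by_contra hn
      have := h2 x hxS _ hn (adj_add_unitVec x i₀)
      linarith
    have := hx (x + unitVec i₀) ⟨hmem, he.trans hxv⟩
    simp [unitVec] at this
  have : nbrSum v x < ∑ _i : Fin d, (v x + v x) := by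
    refine Finset.sum_lt_sum (fun i _ => ?_) ⟨i₀, Finset.mem_univ _, ?_⟩
    · exact add_le_add (hnb _ (adj_add_unitVec x i)) (hnb _ (adj_sub_unitVec x i))
    · exact add_lt_add_of_lt_of_le hlt (hnb _ (adj_sub_unitVec x i₀))
  simp only [Finset.sum_const, Finset.card_univ, Fintype.card_fin, nsmul_eq_mul] at this
  nlinarith

theorem le_of_subharmonic (hd : 0 < d) {S : Set (Lattice d)} (hS : S.Finite)
    {v : Lattice d → ℝ} {M : ℝ} (h1 : ∀ x ∈ S, 0 ≤ lap v x)
    (h2 : ∀ x ∈ S, ∀ y ∉ S, Adj x y → v y ≤ M) : ∀ x ∈ S, v x ≤ M := fun x hx =>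
  le_of_forall_gt_imp_ge_of_dense fun _ hM' =>
    (lt_of_subharmonic hd hS (fun x hx _ => h1 x hx)
      (fun x hx y hy hxy => (h2 x hx y hy hxy).trans_lt hM') x hx).le

theorem ge_of_superharmonic (hd : 0 < d) {S : Set (Lattice d)} (hS : S.Finite)
    {v : Lattice d → ℝ} {M : ℝ} (h1 : ∀ x ∈ S, lap v x ≤ 0)
    (h2 : ∀ x ∈ S, ∀ y ∉ S, Adj x y → M ≤ v y) : ∀ x ∈ S, M ≤ v x := by
  intro x hx
  have := le_of_subharmonic hd hS (v := fun y => (-1) * v y) (M := -M)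
    (fun x hx => by rw [lap_const_mul]; linarith [h1 x hx])
    (fun x hx y hy hxy => by linarith [h2 x hx y hy hxy]) x hx
  linarith

/-! ### Odometers and the least action principle. -/

/-- The odometer: the mass emitted from each site in the first `n` steps. -/
def odometer (σ : Lattice d → ℝ) (T : ℕ → Lattice d) : ℕ → Lattice d → ℝ
  | 0 => fun _ => 0
  | n + 1 => fun y => odometer σ T n y +
      if y = T n then max (massAt σ T n (T n) - 1) 0 else 0

/-- Emitting mass a from a site changes the configuration by the Laplacian of a times the indicator
of that site. -/
theorem massAt_eq (σ : Lattice d → ℝ) (T : ℕ → Lattice d) (n : ℕ) (x : Lattice d) :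
    massAt σ T n x = σ x + lap (odometer σ T n) x := by
  induction n generalizing x with
  | zero => simp [massAt, odometer, lap, nbrSum]
  | succ n ih =>
    simp only [massAt, odometer, lap_add]
    rw [← add_assoc, ← ih]
    unfold topple lap
    rw [nbrSum_indicator]
    by_cases hx : x = T n
    · subst hx
      simp only [if_true, not_adj_self, if_false]
      rcases le_total (massAt σ T n (T n)) 1 with h | h
      · rw [min_eq_left h, max_eq_right (by linarith)]; simp
      · rw [min_eq_right h, max_eq_left (by linarith)]; ring
    · by_cases ha : Adj (T n) x
      · simp [hx, ha]
      · simp [hx, ha]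

theorem odometer_mono (σ : Lattice d → ℝ) (T : ℕ → Lattice d) (x : Lattice d) :
    Monotone fun n => odometer σ T n x := by
  refine monotone_nat_of_le_succ fun n => ?_
  simp only [odometer]
  split_ifs
  · linarith [le_max_right (massAt σ T n (T n) - 1) 0]
  · simp

theorem odometer_nonneg (σ : Lattice d → ℝ) (T : ℕ → Lattice d) (n : ℕ) (x : Lattice d) :
    0 ≤ odometer σ T n x := odometer_mono σ T x (Nat.zero_le n)

theorem odometer_finite (σ : Lattice d → ℝ) (T : ℕ → Lattice d) (n : ℕ) :
    {x | odometer σ T n x ≠ 0}.Finite := by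
  induction n with
  | zero => simp [odometer]
  | succ n ih =>
    refine (ih.union (Set.finite_singleton (T n))).subset fun x hx => ?_
    by_contra hc
    simp only [Set.mem_union, Set.mem_ofPred_eq, Set.mem_singleton_iff, not_or, not_not] at hc
    simp [odometer, hc] at hx

theorem massAt_nonneg {σ : Lattice d → ℝ} (hσ : ∀ x, 0 ≤ σ x) (T : ℕ → Lattice d) (n : ℕ)
    (x : Lattice d) : 0 ≤ massAt σ T n x := by
  induction n generalizing x with
  | zero => exact hσ x
  | succ n ih =>
    simp only [massAt, topple]
    split_ifs with h1 h2
    · exact le_min (ih _) zero_le_one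
    · exact add_nonneg (ih _) (by positivity)
    · exact ih _

theorem nbrSum_mono {f g : Lattice d → ℝ} (h : ∀ x, f x ≤ g x) (x : Lattice d) :
    nbrSum f x ≤ nbrSum g x :=
  Finset.sum_le_sum fun _ _ => add_le_add (h _) (h _)

/-- The least action principle. -/
theorem odometer_le {σ w : Lattice d → ℝ} (hw : ∀ x, 0 ≤ w x)
    (hσ : ∀ x, σ x + lap w x ≤ 1) (T : ℕ → Lattice d) (n : ℕ) (x : Lattice d) :
    odometer σ T n x ≤ w x := by
  induction n generalizing x with
  | zero => exact hw x
  | succ n ih =>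
    simp only [odometer]
    split_ifs with hx
    · subst hx
      rcases le_total (massAt σ T n (T n)) 1 with h | h
      · rw [max_eq_right (by linarith)]; simpa using ih (T n)
      -- After the toppling, the odometer at this site is its neighbour average plus σ - 1. This is
      -- monotone in the neighbours, and the same expression for `w` is at most `w`.
      · rw [max_eq_left (by linarith), massAt_eq]
        have h1 := hσ (T n)
        have h2 : nbrSum (odometer σ T n) (T n) / (2 * d) ≤ nbrSum w (T n) / (2 * d) := by
          have := nbrSum_mono ih (T n)
          gcongr
        unfold lap at h1 ⊢
        linarith
    · simpa using ih x

/-- A site that has emitted mass was left with mass 1, and later topplings never take it below 1. -/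
theorem one_le_massAt {σ : Lattice d → ℝ} {T : ℕ → Lattice d} {n : ℕ} {x : Lattice d}
    (h : 0 < odometer σ T n x) : 1 ≤ massAt σ T n x := by
  induction n with
  | zero => simp [odometer] at h
  | succ n ih =>
    simp only [odometer] at h
    simp only [massAt, topple]
    split_ifs at h ⊢ with h1 h2
    · subst h1
      rcases le_total (massAt σ T n (T n)) 1 with h' | h'
      · rw [max_eq_right (by linarith), add_zero] at h
        exact le_min (ih h) le_rfl
      · exact le_min h' le_rfl
    · have := ih (by simpa using h)
      have : 0 ≤ max (massAt σ T n (T n) - 1) 0 / (2 * d) := by positivity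
      linarith
    · exact ih (by simpa using h)

theorem tendsto_lap {u : ℕ → Lattice d → ℝ} {U : Lattice d → ℝ}
    (h : ∀ x, Tendsto (fun n => u n x) atTop (𝓝 (U x))) (x : Lattice d) :
    Tendsto (fun n => lap (u n) x) atTop (𝓝 (lap U x)) := by
  unfold lap nbrSum
  exact ((tendsto_finsetSum _ fun i _ => (h _).add (h _)).div_const _).sub (h x)

/-- If the obstacle problem has a supersolution, then the odometers converge to a function `u`
which does not depend on the toppling sequence. -/
theorem exists_odometer_limit {σ w : Lattice d → ℝ} (hw : ∀ x, 0 ≤ w x)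
    (hσ : ∀ x, σ x + lap w x ≤ 1) :
    ∃ u : Lattice d → ℝ, (∀ x, 0 ≤ u x) ∧ (∀ x, u x ≤ w x) ∧ (∀ x, σ x + lap u x ≤ 1) ∧
      (∀ x, 0 < u x → σ x + lap u x = 1) ∧
      IsLimitingMass σ (fun x => σ x + lap u x) ∧
      ∃ T : ℕ → Lattice d, ∀ x, Tendsto (fun n => odometer σ T n x) atTop (𝓝 (u x)) := by
  have key : ∀ T : ℕ → Lattice d, EveryFullSiteToppled σ T → ∃ u : Lattice d → ℝ,
      (∀ x, 0 ≤ u x) ∧ (∀ x, u x ≤ w x) ∧ (∀ x, σ x + lap u x ≤ 1) ∧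
      (∀ x, 0 < u x → σ x + lap u x = 1) ∧
      (∀ x, Tendsto (fun n => odometer σ T n x) atTop (𝓝 (u x))) := by
    intro T hT
    let u : Lattice d → ℝ := fun x => ⨆ n, odometer σ T n x
    have hb : ∀ x, BddAbove (Set.range fun n => odometer σ T n x) := fun x =>
      ⟨w x, by rintro _ ⟨n, rfl⟩; exact odometer_le hw hσ T n x⟩
    have hu : ∀ x, Tendsto (fun n => odometer σ T n x) atTop (𝓝 (u x)) := fun x =>
      tendsto_atTop_ciSup (odometer_mono σ T x) (hb x)
    have hmass : ∀ x, Tendsto (fun n => massAt σ T n x) atTop (𝓝 (σ x + lap u x)) := by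
      intro x
      simp only [massAt_eq]
      exact (tendsto_lap hu x).const_add _
    have hle : ∀ x, σ x + lap u x ≤ 1 := by
      intro x
      by_contra! hc
      -- A limit above 1 keeps the mass above 1 from time `N` on, but the next toppling at `x`
      -- leaves at most 1.
      obtain ⟨N, hN⟩ := eventually_atTop.1 ((hmass x).eventually_const_lt hc)
      obtain ⟨k, hk, hkx⟩ := hT N x (hN N le_rfl).le
      have h1 := hN (k + 1) (by omega)
      simp only [massAt, topple, hkx, if_true] at h1
      exact absurd h1 (not_lt.2 (min_le_right _ _))
    refine ⟨u, fun x => ge_of_tendsto' (hu x) fun n => odometer_nonneg σ T n x,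
      fun x => le_of_tendsto' (hu x) fun n => odometer_le hw hσ T n x, hle, ?_, hu⟩
    intro x hx
    refine le_antisymm (hle x) (ge_of_tendsto (hmass x) ?_)
    filter_upwards [(hu x).eventually_const_lt hx] with n hn
    exact one_le_massAt hn
  obtain ⟨T₀, hT₀⟩ := exists_everyFullSiteToppled σ
  obtain ⟨u, h0, h1, h2, h3, h4⟩ := key T₀ hT₀
  refine ⟨u, h0, h1, h2, h3, ⟨h2, fun T hT x => ?_⟩, T₀, h4⟩
  obtain ⟨u', h0', h1', h2', h3', h4'⟩ := key T hT
  -- Each limit is itself a supersolution, so it dominates the odometers of the other sequence.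
  have : u' = u := by
    funext y
    exact le_antisymm (le_of_tendsto' (h4' y) fun n => odometer_le h0 h2 T n y)
      (le_of_tendsto' (h4 y) fun n => odometer_le h0' h2' T₀ n y)
  subst this
  simp only [massAt_eq]
  exact (tendsto_lap h4' x).const_add _

/-! ### One-dimensional heat kernels and shifted Fourier contours. -/

/-- The heat kernel of the continuous-time simple random walk on `ℤ`. -/
def kern (t : ℝ) (k : ℤ) : ℝ :=
  (2 * Real.pi)⁻¹ * ∫ θ in (-Real.pi)..Real.pi,
    Real.exp (-(t * (1 - Real.cos θ))) * Real.cos (k * θ)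

/-- The heat kernel of Brownian motion on `ℝ`. -/
def gauss (t y : ℝ) : ℝ := (2 * Real.pi * t) ^ (-(1 / 2) : ℝ) * Real.exp (-(y ^ 2 / (2 * t)))

theorem kern_neg (t : ℝ) (k : ℤ) : kern t (-k) = kern t k := by
  simp [kern]

theorem kern_abs (t : ℝ) (k : ℤ) : kern t |k| = kern t k := by
  rcases abs_choice k with h | h <;> rw [h]
  exact kern_neg t k

theorem kern_zero (k : ℤ) : kern 0 k = if k = 0 then 1 else 0 := by
  unfold kern
  simp only [zero_mul, neg_zero, Real.exp_zero, one_mul]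
  split_ifs with h
  · subst h
    simp only [Int.cast_zero, zero_mul, Real.cos_zero, intervalIntegral.integral_const,
      smul_eq_mul, mul_one]
    have := Real.pi_ne_zero
    field_simp; ring
  · have hk : (k : ℝ) ≠ 0 := by exact_mod_cast h
    rw [intervalIntegral.integral_comp_mul_left (fun x => Real.cos x) hk, integral_cos]
    simp [Real.sin_int_mul_pi]

/-- Differentiation under the integral, together with 2 cos θ cos kθ = cos (k+1)θ + cos (k-1)θ. -/
theorem kern_hasDerivAt (t : ℝ) (k : ℤ) :
    HasDerivAt (fun t => kern t k) ((kern t (k + 1) + kern t (k - 1)) / 2 - kern t k) t := by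
  have hcont : ∀ (t : ℝ) (k : ℤ), Continuous fun θ : ℝ =>
      Real.exp (-(t * (1 - Real.cos θ))) * Real.cos (k * θ) := fun t k => by fun_prop
  have hder := (intervalIntegral.hasDerivAt_integral_of_dominated_loc_of_deriv_le
    (μ := volume) (a := -Real.pi) (b := Real.pi) (𝕜 := ℝ)
    (F := fun t θ => Real.exp (-(t * (1 - Real.cos θ))) * Real.cos (k * θ))
    (F' := fun t θ => Real.exp (-(t * (1 - Real.cos θ))) * (-(1 - Real.cos θ)) *
      Real.cos (k * θ))
    (bound := fun _ => Real.exp ((|t| + 1) * 2) * 2) (x₀ := t)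
    (Metric.ball_mem_nhds t one_pos)
    (Eventually.of_forall fun s => (hcont s k).aestronglyMeasurable)
    ((hcont t k).intervalIntegrable _ _)
    (by
      have : Continuous fun θ : ℝ => Real.exp (-(t * (1 - Real.cos θ))) * (-(1 - Real.cos θ)) *
        Real.cos (k * θ) := by fun_prop
      exact this.aestronglyMeasurable)
    (by
      refine Eventually.of_forall fun θ _ s hs => ?_
      have hs' : |s| ≤ |t| + 1 := by
        have h1 : |s - t| < 1 := by simpa [Real.dist_eq] using hs
        have := abs_sub_abs_le_abs_sub s t
        linarith
      have h1 : |1 - Real.cos θ| ≤ 2 := by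
        rw [abs_le]; constructor <;> linarith [Real.cos_le_one θ, Real.neg_one_le_cos θ]
      rw [norm_mul, norm_mul, Real.norm_eq_abs, Real.norm_eq_abs, Real.norm_eq_abs,
        abs_of_pos (Real.exp_pos _), abs_neg]
      have h2 : Real.exp (-(s * (1 - Real.cos θ))) ≤ Real.exp ((|t| + 1) * 2) := by
        apply Real.exp_le_exp.2
        calc -(s * (1 - Real.cos θ)) ≤ |s * (1 - Real.cos θ)| := neg_le_abs _
          _ = |s| * |1 - Real.cos θ| := abs_mul _ _
          _ ≤ _ := by gcongr
      calc _ ≤ Real.exp ((|t| + 1) * 2) * 2 * 1 := by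
            gcongr
            exact Real.abs_cos_le_one _
        _ = _ := by ring)
    (by simp)
    (by
      refine Eventually.of_forall fun θ _ s _ => ?_
      have h1 : HasDerivAt (fun s : ℝ => -(s * (1 - Real.cos θ))) (-(1 - Real.cos θ)) s :=
        ((hasDerivAt_id' s).mul_const (1 - Real.cos θ)).fun_neg.congr_deriv (by ring)
      exact (h1.exp).mul_const _)).2
  have h := hder.const_mul (2 * Real.pi)⁻¹
  refine h.congr_deriv ?_
  have hi := fun k : ℤ => (hcont t k).intervalIntegrable (μ := volume) (-Real.pi) Real.pi
  unfold kern
  have : ∫ θ in (-Real.pi)..Real.pi, Real.exp (-(t * (1 - Real.cos θ))) * (-(1 - Real.cos θ)) *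
      Real.cos (k * θ) =
      ((∫ θ in (-Real.pi)..Real.pi, Real.exp (-(t * (1 - Real.cos θ))) *
        Real.cos ((k + 1 : ℤ) * θ)) +
      ∫ θ in (-Real.pi)..Real.pi, Real.exp (-(t * (1 - Real.cos θ))) *
        Real.cos ((k - 1 : ℤ) * θ)) / 2 -
      ∫ θ in (-Real.pi)..Real.pi, Real.exp (-(t * (1 - Real.cos θ))) * Real.cos (k * θ) := by
    rw [← intervalIntegral.integral_add (hi _) (hi _), ← intervalIntegral.integral_div,
      ← intervalIntegral.integral_sub (((hi _).add (hi _)).div_const _) (hi _)]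
    congr 1
    funext θ
    push_cast
    rw [add_mul, sub_mul, one_mul, Real.cos_add, Real.cos_sub]
    ring
  rw [this]; ring

/-- The integrand of the Fourier representation of `kern`, on the complex plane. -/
def kernFun (t : ℝ) (k : ℤ) (z : ℂ) : ℂ :=
  Complex.exp (-(t * (1 - Complex.cos z))) * Complex.exp (Complex.I * k * z)

theorem kernFun_differentiable (t : ℝ) (k : ℤ) : Differentiable ℂ (kernFun t k) := by
  unfold kernFun
  fun_prop

/-- Cauchy's theorem on a rectangle: the vertical sides cancel because the integrand is 2π-periodic
for integer `k`. The shift produces the factor exp(-kl). -/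
theorem kern_eq_shift (t : ℝ) (k : ℤ) (l : ℝ) :
    kern t k = (2 * Real.pi)⁻¹ *
      (∫ θ in (-Real.pi)..Real.pi, kernFun t k (θ + l * Complex.I)).re := by
  have hrect := Complex.integral_boundary_rect_eq_zero_of_differentiableOn (kernFun t k)
    (-Real.pi : ℝ) (Real.pi + l * Complex.I) (kernFun_differentiable t k).differentiableOn
  have hper : ∀ y : ℝ, kernFun t k (Real.pi + y * Complex.I) =
      kernFun t k ((-Real.pi : ℝ) + y * Complex.I) := by
    intro y
    have h1 : (Real.pi + y * Complex.I : ℂ) =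
        ((-Real.pi : ℝ) + y * Complex.I) + 2 * Real.pi := by push_cast; ring
    rw [h1]
    unfold kernFun
    rw [Complex.cos_add_two_pi, mul_add, Complex.exp_add]
    have h2 : Complex.exp (Complex.I * k * (2 * Real.pi)) = 1 := by
      rw [Complex.exp_eq_one_iff]
      exact ⟨k, by ring⟩
    rw [h2, mul_one]
  simp only [Complex.ofReal_re, Complex.ofReal_im, Complex.add_re, Complex.add_im,
    Complex.mul_re, Complex.mul_im, Complex.I_re, Complex.I_im, mul_zero, mul_one, zero_add,
    sub_zero, add_zero, Complex.ofReal_zero, zero_mul] at hrect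
  simp only [hper] at hrect
  rw [add_sub_cancel_right, sub_eq_zero] at hrect
  rw [← hrect]
  unfold kern
  congr 1
  have hint : IntervalIntegrable (fun θ : ℝ => kernFun t k θ) volume (-Real.pi) Real.pi :=
    ((kernFun_differentiable t k).continuous.comp Complex.continuous_ofReal).intervalIntegrable _ _
  have h1 := Complex.reCLM.intervalIntegral_comp_comm hint
  simp only [Complex.reCLM_apply] at h1
  rw [← h1]
  congr 1
  funext θ
  have h2 : Complex.exp (-(t * (1 - Complex.cos θ))) =
      ((Real.exp (-(t * (1 - Real.cos θ))) : ℝ) : ℂ) := by push_cast; rfl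
  have h3 : (Complex.exp (Complex.I * k * θ)).re = Real.cos (k * θ) := by
    have : (Complex.I * k * θ : ℂ) = ((k * θ : ℝ) : ℂ) * Complex.I := by push_cast; ring
    rw [this, Complex.exp_ofReal_mul_I_re]
  unfold kernFun
  rw [h2, Complex.re_ofReal_mul, h3]

/-- The integrand of the Fourier representation of `gauss`, on the complex plane. -/
def gaussFun (t : ℝ) (k : ℤ) (z : ℂ) : ℂ :=
  Complex.exp (-(t * (z ^ 2 / 2))) * Complex.exp (Complex.I * k * z)

theorem gaussFun_shift_eq (t : ℝ) (k : ℤ) (l θ : ℝ) :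
    gaussFun t k (θ + l * Complex.I) = Complex.exp ((-(t / 2 : ℝ) : ℂ) * (θ : ℂ) ^ 2 +
      (Complex.I * (k - t * l)) * (θ : ℂ) + (t * l ^ 2 / 2 - k * l : ℝ)) := by
  unfold gaussFun
  rw [← Complex.exp_add]
  congr 1
  push_cast
  have := Complex.I_sq
  linear_combination (-(t * l ^ 2 : ℂ) / 2 + k * l) * this

theorem gaussFun_integrable {t : ℝ} (ht : 0 < t) (k : ℤ) (l : ℝ) :
    Integrable fun θ : ℝ => gaussFun t k (θ + l * Complex.I) := by
  simp only [gaussFun_shift_eq]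
  refine integrable_cexp_quadratic' ?_ _ _
  simp [ht]

theorem gauss_eq_shift {t : ℝ} (ht : 0 < t) (k : ℤ) (l : ℝ) :
    gauss t k = (2 * Real.pi)⁻¹ * (∫ θ : ℝ, gaussFun t k (θ + l * Complex.I)).re := by
  simp only [gaussFun_shift_eq]
  rw [integral_cexp_quadratic (by simp [ht])]
  have hpi := Real.pi_pos
  have h1 : (Real.pi / -(-(t / 2 : ℝ) : ℂ)) ^ (1 / 2 : ℂ) =
      (((Real.pi / (t / 2)) ^ (1 / 2 : ℝ) : ℝ) : ℂ) := by
    rw [Complex.ofReal_cpow (by positivity)]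
    push_cast
    rw [neg_neg]
  have ht' : (t : ℂ) ≠ 0 := by exact_mod_cast ht.ne'
  have h2 : ((t * l ^ 2 / 2 - k * l : ℝ) : ℂ) -
      (Complex.I * (k - t * l)) ^ 2 / (4 * (-(t / 2 : ℝ) : ℂ)) =
      ((-((k : ℝ) ^ 2 / (2 * t)) : ℝ) : ℂ) := by
    rw [mul_pow, Complex.I_sq]
    push_cast
    field_simp
    ring
  have h3 : (Real.pi / (t / 2)) ^ (1 / 2 : ℝ) =
      2 * Real.pi * (2 * Real.pi * t) ^ (-(1 / 2) : ℝ) := by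
    rw [show Real.pi / (t / 2) = (2 * Real.pi) ^ 2 * (2 * Real.pi * t)⁻¹ by field_simp,
      Real.mul_rpow (by positivity) (by positivity), ← Real.sqrt_eq_rpow,
      Real.sqrt_sq (by positivity), Real.rpow_neg (by positivity),
      Real.inv_rpow (by positivity)]
  rw [h1, h2, ← Complex.ofReal_exp, ← Complex.ofReal_mul, Complex.ofReal_re, h3]
  unfold gauss
  field_simp

/-! ### Local central limit theorem in dimension one. -/

theorem norm_cexp_sub_le {a b : ℂ} {M : ℝ} (ha : a.re ≤ M) (hb : b.re ≤ M) :
    ‖Complex.exp a - Complex.exp b‖ ≤ Real.exp M * ‖a - b‖ := by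
  refine Convex.norm_image_sub_le_of_norm_deriv_le (𝕜 := ℂ) (s := {z : ℂ | z.re ≤ M})
    (fun x _ => Complex.differentiable_exp x) (fun x hx => ?_) (convex_halfSpace_re_le M) hb ha
  rw [Complex.deriv_exp, Complex.norm_exp]
  exact Real.exp_le_exp.2 hx

/-- Average the cubic Taylor expansions of exp(iz) and exp(-iz); the odd terms cancel. -/
theorem norm_one_sub_cos_sub_le (z : ℂ) :
    ‖1 - Complex.cos z - z ^ 2 / 2‖ ≤ ‖z‖ ^ 4 * Real.exp ‖z‖ := by
  have h1 := Complex.norm_exp_sub_sum_le_norm_mul_exp (z * Complex.I) 4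
  have h2 := Complex.norm_exp_sub_sum_le_norm_mul_exp (-z * Complex.I) 4
  simp only [Finset.sum_range_succ, Finset.sum_range_zero, Nat.factorial, norm_mul, norm_neg,
    Complex.norm_I, mul_one] at h1 h2
  have hI := Complex.I_sq
  have h3 : 1 - Complex.cos z - z ^ 2 / 2 =
      -((Complex.exp (z * Complex.I) - (0 + (z * Complex.I) ^ 0 / ((1 : ℕ) : ℂ) +
        (z * Complex.I) ^ 1 / (((0 + 1) * 1 : ℕ) : ℂ) +
        (z * Complex.I) ^ 2 / (((1 + 1) * ((0 + 1) * 1) : ℕ) : ℂ) +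
        (z * Complex.I) ^ 3 / (((2 + 1) * ((1 + 1) * ((0 + 1) * 1)) : ℕ) : ℂ))) +
      (Complex.exp (-z * Complex.I) - (0 + (-z * Complex.I) ^ 0 / ((1 : ℕ) : ℂ) +
        (-z * Complex.I) ^ 1 / (((0 + 1) * 1 : ℕ) : ℂ) +
        (-z * Complex.I) ^ 2 / (((1 + 1) * ((0 + 1) * 1) : ℕ) : ℂ) +
        (-z * Complex.I) ^ 3 / (((2 + 1) * ((1 + 1) * ((0 + 1) * 1)) : ℕ) : ℂ)))) / 2 := by
    unfold Complex.cos
    push_cast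
    linear_combination (-z ^ 2 / 2) * hI
  rw [h3, norm_div, norm_neg, Complex.norm_ofNat]
  have h4 := norm_add_le_of_le h1 h2
  push_cast at h4 ⊢
  linarith

theorem cos_add_mul_I_re (θ l : ℝ) :
    (Complex.cos (θ + l * Complex.I)).re = Real.cos θ * Real.cosh l := by
  rw [Complex.cos_add_mul_I, ← Complex.ofReal_cos, ← Complex.ofReal_cosh, ← Complex.ofReal_sin,
    ← Complex.ofReal_sinh, ← Complex.ofReal_mul, ← Complex.ofReal_mul, Complex.sub_re,
    Complex.ofReal_re, Complex.re_ofReal_mul, Complex.I_re, mul_zero, sub_zero]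

theorem norm_cexp_I_mul (k : ℤ) (θ l : ℝ) :
    ‖Complex.exp (Complex.I * k * (θ + l * Complex.I))‖ = Real.exp (-(k * l)) := by
  rw [Complex.norm_exp]
  congr 1
  simp

theorem kernFun_exponent_re (t θ l : ℝ) :
    (-(t * (1 - Complex.cos (θ + l * Complex.I))) : ℂ).re =
      -(t * (1 - Real.cos θ * Real.cosh l)) := by
  rw [Complex.neg_re, Complex.re_ofReal_mul, Complex.sub_re, cos_add_mul_I_re, Complex.one_re]

theorem gaussFun_exponent_re (t θ l : ℝ) :
    (-(t * ((θ + l * Complex.I) ^ 2 / 2)) : ℂ).re = -(t * ((θ ^ 2 - l ^ 2) / 2)) := by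
  have : (-(t * ((θ + l * Complex.I) ^ 2 / 2)) : ℂ) =
      ((-(t * ((θ ^ 2 - l ^ 2) / 2)) : ℝ) : ℂ) + ((-(t * θ * l) : ℝ) : ℂ) * Complex.I := by
    push_cast
    linear_combination (-(t * l ^ 2) / 2 : ℂ) * Complex.I_sq
  rw [this, Complex.add_re, Complex.ofReal_re, Complex.re_ofReal_mul, Complex.I_re]
  ring

theorem cosh_sub_one_le {l : ℝ} (h0 : 0 ≤ l) (h1 : l ≤ 1) : Real.cosh l - 1 ≤ l ^ 2 := by
  have h2 := Real.cosh_le_exp_half_sq l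
  have hl : l ^ 2 ≤ 1 := by nlinarith
  have h3 := (abs_le.1 (Real.abs_exp_sub_one_le (x := l ^ 2 / 2)
    (by rw [abs_of_nonneg (by positivity)]; linarith))).2
  rw [abs_of_nonneg (by positivity)] at h3
  linarith

/-- Half of the Gaussian decay is spent on absorbing the polynomial factor. -/
theorem sq_mul_exp_le {y : ℝ} (hy : 0 ≤ y) :
    (1 + y) ^ 2 * Real.exp (-(y / 5)) ≤ 200 * Real.exp (-(y / 10)) := by
  have h1 := Real.quadratic_le_exp_of_nonneg (x := y / 10) (by positivity)
  have h2 : (1 + y) ^ 2 ≤ 200 * Real.exp (y / 10) := by nlinarith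
  calc (1 + y) ^ 2 * Real.exp (-(y / 5)) ≤ 200 * Real.exp (y / 10) * Real.exp (-(y / 5)) := by
        gcongr
    _ = 200 * Real.exp (-(y / 10)) := by
        rw [mul_assoc, ← Real.exp_add]; congr 2; ring

/-- Pointwise comparison of the shifted Fourier transforms. -/
theorem norm_kernFun_sub_gaussFun_le {t l : ℝ} (ht : 1 ≤ t) (hl : 0 < l) (htl : t * l ^ 2 = 1)
    (k : ℤ) (θ : ℝ) :
    ‖(Set.Ioc (-Real.pi) Real.pi).indicator
        (fun θ : ℝ => kernFun t k (θ + l * Complex.I)) θ - gaussFun t k (θ + l * Complex.I)‖ ≤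
      200 * Real.exp 6 * t⁻¹ * Real.exp (-(k * l)) * Real.exp (-(t / 10) * θ ^ 2) := by
  have ht0 : 0 < t := by linarith
  have hl1 : l ≤ 1 := by nlinarith
  have hy : 0 ≤ t * θ ^ 2 := by positivity
  have hexp := sq_mul_exp_le hy
  have hpi := Real.pi_lt_d2
  have hpi3 := Real.pi_gt_three
  have hre : -(t / 10) * θ ^ 2 = -(t * θ ^ 2 / 10) := by ring
  rw [hre]
  by_cases hθ : θ ∈ Set.Ioc (-Real.pi) Real.pi
  · rw [Set.indicator_of_mem hθ]
    unfold kernFun gaussFun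
    rw [← sub_mul, norm_mul, norm_cexp_I_mul]
    have habs : |θ| ≤ Real.pi := abs_le.2 ⟨hθ.1.le, hθ.2⟩
    have hcos := Real.cos_le_one_sub_mul_cos_sq habs
    have hcos2 : Real.cos θ ≤ 1 - θ ^ 2 / 5 := by
      have h1 : (1 / 5 : ℝ) ≤ 2 / Real.pi ^ 2 := by
        rw [div_le_div_iff₀ (by norm_num) (by positivity)]
        nlinarith
      have := mul_le_mul_of_nonneg_right h1 (sq_nonneg θ)
      linarith
    have hcosh := cosh_sub_one_le hl.le hl1
    have hcosh1 := Real.one_le_cosh l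
    have hc : Real.cos θ * Real.cosh l ≤ 1 - θ ^ 2 / 5 + l ^ 2 := by
      have h3 := Real.cos_le_one θ
      nlinarith
    have hA : (-(t * (1 - Complex.cos (θ + l * Complex.I))) : ℂ).re ≤ 1 - t * θ ^ 2 / 5 := by
      rw [kernFun_exponent_re]
      nlinarith
    have hB : (-(t * ((θ + l * Complex.I) ^ 2 / 2)) : ℂ).re ≤ 1 - t * θ ^ 2 / 5 := by
      rw [gaussFun_exponent_re]
      nlinarith
    have hz : ‖(θ + l * Complex.I : ℂ)‖ ^ 2 = θ ^ 2 + l ^ 2 := by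
      rw [← Complex.normSq_eq_norm_sq, Complex.normSq_add_mul_I]
    have hz1 : ‖(θ + l * Complex.I : ℂ)‖ ≤ 5 := by
      have : ‖(θ + l * Complex.I : ℂ)‖ ^ 2 ≤ 5 ^ 2 := by
        rw [hz]; nlinarith [abs_le.1 habs]
      exact le_of_sq_le_sq this (by norm_num)
    -- Since t l² = 1, t|z|² = 1 + tθ², so the quartic error t|z|⁴ becomes t⁻¹(1 + tθ²)².
    have hdiff : ‖(-(t * (1 - Complex.cos (θ + l * Complex.I))) : ℂ) -
        -(t * ((θ + l * Complex.I) ^ 2 / 2))‖ ≤ t⁻¹ * (1 + t * θ ^ 2) ^ 2 * Real.exp 5 := by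
      have h1 : (-(t * (1 - Complex.cos (θ + l * Complex.I))) : ℂ) -
          -(t * ((θ + l * Complex.I) ^ 2 / 2)) = -(t * (1 - Complex.cos (θ + l * Complex.I) -
            (θ + l * Complex.I) ^ 2 / 2)) := by ring
      rw [h1, norm_neg, norm_mul, Complex.norm_real, Real.norm_of_nonneg ht0.le]
      calc t * _ ≤ t * (‖(θ + l * Complex.I : ℂ)‖ ^ 4 * Real.exp ‖(θ + l * Complex.I : ℂ)‖) := by
            gcongr; exact norm_one_sub_cos_sub_le _
        _ ≤ t * (‖(θ + l * Complex.I : ℂ)‖ ^ 4 * Real.exp 5) := by gcongr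
        _ = t⁻¹ * (t * ‖(θ + l * Complex.I : ℂ)‖ ^ 2) ^ 2 * Real.exp 5 := by
            field_simp
        _ = _ := by rw [hz, mul_add, htl, add_comm (t * θ ^ 2)]
    calc _ ≤ Real.exp (1 - t * θ ^ 2 / 5) * (t⁻¹ * (1 + t * θ ^ 2) ^ 2 * Real.exp 5) *
          Real.exp (-(k * l)) := by
          gcongr
          exact (norm_cexp_sub_le hA hB).trans (by gcongr)
      _ = Real.exp 6 * t⁻¹ * Real.exp (-(k * l)) *
          ((1 + t * θ ^ 2) ^ 2 * Real.exp (-(t * θ ^ 2 / 5))) := by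
          rw [sub_eq_add_neg, Real.exp_add, show (6 : ℝ) = 1 + 5 by norm_num, Real.exp_add 1 5]
          ring
      _ ≤ Real.exp 6 * t⁻¹ * Real.exp (-(k * l)) * (200 * Real.exp (-(t * θ ^ 2 / 10))) := by
          gcongr
      _ = _ := by ring
  -- Outside the period only the Gaussian remains. There θ² ≥ 1, so t⁻¹(1 + tθ²)² ≥ 1 can be
  -- inserted freely.
  · rw [Set.indicator_of_notMem hθ, zero_sub, norm_neg]
    unfold gaussFun
    rw [norm_mul, norm_cexp_I_mul, Complex.norm_exp, gaussFun_exponent_re]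
    have hθ1 : 1 ≤ θ ^ 2 := by
      simp only [Set.mem_Ioc, not_and_or, not_lt, not_le] at hθ
      rcases hθ with h | h <;> nlinarith
    have h1 : 1 ≤ t⁻¹ * (1 + t * θ ^ 2) ^ 2 := by
      rw [inv_mul_eq_div, one_le_div ht0]
      nlinarith
    have h2 : Real.exp (-(t * ((θ ^ 2 - l ^ 2) / 2))) ≤
        Real.exp 6 * Real.exp (-(t * θ ^ 2 / 5)) := by
      rw [← Real.exp_add]
      apply Real.exp_le_exp.2
      nlinarith
    calc _ ≤ 1 * (Real.exp 6 * Real.exp (-(t * θ ^ 2 / 5))) * Real.exp (-(k * l)) := by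
          rw [one_mul]; gcongr
      _ ≤ t⁻¹ * (1 + t * θ ^ 2) ^ 2 * (Real.exp 6 * Real.exp (-(t * θ ^ 2 / 5))) *
          Real.exp (-(k * l)) := by gcongr
      _ = Real.exp 6 * t⁻¹ * Real.exp (-(k * l)) *
          ((1 + t * θ ^ 2) ^ 2 * Real.exp (-(t * θ ^ 2 / 5))) := by ring
      _ ≤ Real.exp 6 * t⁻¹ * Real.exp (-(k * l)) * (200 * Real.exp (-(t * θ ^ 2 / 10))) := by
          gcongr
      _ = _ := by ring

/-- The local central limit theorem in dimension one, with exponential off-diagonal decay. -/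
theorem exists_kern_sub_gauss_le : ∃ C : ℝ, 0 ≤ C ∧ ∀ (t : ℝ) (k : ℤ), 1 ≤ t →
    |kern t k - gauss t k| ≤ C * t ^ (-(3 / 2) : ℝ) * Real.exp (-(|(k : ℝ)| / √t)) := by
  refine ⟨(2 * Real.pi)⁻¹ * (200 * Real.exp 6 * √(Real.pi * 10)), by positivity, ?_⟩
  intro t k ht
  have ht0 : 0 < t := by linarith
  have hl : 0 < (√t)⁻¹ := by positivity
  have htl : t * (√t)⁻¹ ^ 2 = 1 := by
    rw [inv_pow, Real.sq_sqrt ht0.le, mul_inv_cancel₀ ht0.ne']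
  -- Both kernels are even; passing to |k| makes an upward shift give decay.
  have hg : gauss t k = gauss t (|k| : ℤ) := by
    unfold gauss; rw [Int.cast_abs, sq_abs]
  rw [← kern_abs, hg, ← Int.cast_abs]
  set n := |k|
  set l := (√t)⁻¹ with hldef
  rw [kern_eq_shift t n l, gauss_eq_shift ht0 n l, ← mul_sub, ← Complex.sub_re, abs_mul,
    abs_of_pos (a := (2 * Real.pi)⁻¹) (by positivity)]
  have hint1 : Integrable ((Set.Ioc (-Real.pi) Real.pi).indicator
      (fun θ : ℝ => kernFun t n (θ + l * Complex.I))) := by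
    rw [integrable_indicator_iff measurableSet_Ioc]
    have hc : Continuous (fun θ : ℝ => kernFun t n (θ + l * Complex.I)) :=
      (kernFun_differentiable t n).continuous.comp (by fun_prop)
    exact hc.integrableOn_Ioc
  rw [intervalIntegral.integral_of_le (by linarith [Real.pi_pos]),
    ← integral_indicator measurableSet_Ioc, ← integral_sub hint1 (gaussFun_integrable ht0 n l)]
  have hb : 0 < t / 10 := by positivity
  have hle := norm_integral_le_of_norm_le
    ((integrable_exp_neg_mul_sq hb).const_mul (200 * Real.exp 6 * t⁻¹ * Real.exp (-(n * l))))
    (Eventually.of_forall fun θ => norm_kernFun_sub_gaussFun_le ht hl htl n θ)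
  rw [integral_const_mul, integral_gaussian] at hle
  have h32 : t⁻¹ * √(Real.pi / (t / 10)) = √(Real.pi * 10) * t ^ (-(3 / 2) : ℝ) := by
    rw [show Real.pi / (t / 10) = Real.pi * 10 / t by field_simp,
      Real.sqrt_div' _ ht0.le, Real.sqrt_eq_rpow t, ← Real.rpow_neg_one t, div_eq_mul_inv,
      ← Real.rpow_neg ht0.le, mul_left_comm, ← Real.rpow_add ht0]
    norm_num
  calc _ ≤ (2 * Real.pi)⁻¹ * (200 * Real.exp 6 * t⁻¹ * Real.exp (-(n * l)) *
        √(Real.pi / (t / 10))) := by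
        gcongr
        exact (Complex.abs_re_le_norm _).trans hle
    _ = (2 * Real.pi)⁻¹ * (200 * Real.exp 6 * (t⁻¹ * √(Real.pi / (t / 10))) *
        Real.exp (-(n * l))) := by ring
    _ = _ := by rw [h32, hldef, div_eq_mul_inv]; ring_nf

theorem gauss_nonneg {t : ℝ} (ht : 0 ≤ t) (y : ℝ) : 0 ≤ gauss t y := by
  unfold gauss; positivity

theorem gauss_le {t : ℝ} (ht : 0 < t) (y : ℝ) :
    gauss t y ≤ Real.exp 1 * t ^ (-(1 / 2) : ℝ) * Real.exp (-(|y| / √t)) := by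
  unfold gauss
  have h1 : (2 * Real.pi * t) ^ (-(1 / 2) : ℝ) ≤ t ^ (-(1 / 2) : ℝ) := by
    apply Real.rpow_le_rpow_of_nonpos ht _ (by norm_num)
    nlinarith [Real.pi_gt_three]
  have h2 : Real.exp (-(y ^ 2 / (2 * t))) ≤ Real.exp 1 * Real.exp (-(|y| / √t)) := by
    rw [← Real.exp_add]
    apply Real.exp_le_exp.2
    have h3 : y ^ 2 / (2 * t) = (|y| / √t) ^ 2 / 2 := by
      rw [div_pow, sq_abs, Real.sq_sqrt ht.le]; field_simp
    rw [h3]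
    nlinarith [sq_nonneg (|y| / √t - 1)]
  calc _ ≤ t ^ (-(1 / 2) : ℝ) * (Real.exp 1 * Real.exp (-(|y| / √t))) := by gcongr
    _ = _ := by ring

theorem exists_kern_le : ∃ C : ℝ, 0 ≤ C ∧ ∀ (t : ℝ) (k : ℤ), 1 ≤ t →
    |kern t k| ≤ C * t ^ (-(1 / 2) : ℝ) * Real.exp (-(|(k : ℝ)| / √t)) := by
  obtain ⟨C, hC, h⟩ := exists_kern_sub_gauss_le
  refine ⟨C + Real.exp 1, by positivity, fun t k ht => ?_⟩
  have h1 := h t k ht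
  have h2 := gauss_le (by linarith : 0 < t) k
  have h3 := gauss_nonneg (by linarith : 0 ≤ t) k
  have h4 : t ^ (-(3 / 2) : ℝ) ≤ t ^ (-(1 / 2) : ℝ) :=
    Real.rpow_le_rpow_of_exponent_le ht (by norm_num)
  calc |kern t k| = |(kern t k - gauss t k) + gauss t k| := by rw [sub_add_cancel]
    _ ≤ |kern t k - gauss t k| + |gauss t k| := abs_add_le _ _
    _ ≤ C * t ^ (-(1 / 2) : ℝ) * Real.exp (-(|(k : ℝ)| / √t)) +
        Real.exp 1 * t ^ (-(1 / 2) : ℝ) * Real.exp (-(|(k : ℝ)| / √t)) := by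
        rw [abs_of_nonneg h3]
        exact add_le_add (h1.trans (by gcongr)) h2
    _ = _ := by ring

/-- For short times a shift of the contour by 1 suffices: the exponent then has real part at most
cosh 1. -/
theorem exists_kern_le_of_le_one : ∃ C : ℝ, 0 ≤ C ∧ ∀ (t : ℝ) (k : ℤ), 0 ≤ t → t ≤ 1 →
    |kern t k| ≤ C * Real.exp (-|(k : ℝ)|) := by
  refine ⟨Real.exp (Real.cosh 1), by positivity, fun t k h0 h1 => ?_⟩
  rw [← kern_abs, ← Int.cast_abs]
  set n := |k|
  rw [kern_eq_shift t n 1, abs_mul, abs_of_pos (a := (2 * Real.pi)⁻¹) (by positivity)]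
  have hle := intervalIntegral.norm_integral_le_of_norm_le_const (a := -Real.pi) (b := Real.pi)
    (f := fun θ : ℝ => kernFun t n (θ + (1 : ℝ) * Complex.I))
    (C := Real.exp (Real.cosh 1) * Real.exp (-n)) (by
      intro θ _
      unfold kernFun
      rw [norm_mul, norm_cexp_I_mul, Complex.norm_exp, kernFun_exponent_re, mul_one]
      gcongr
      have h2 := Real.cosh_pos 1
      have h3 := Real.cos_le_one θ
      have h4 : Real.cos θ * Real.cosh 1 ≤ Real.cosh 1 := by nlinarith
      nlinarith)
  have hpi := Real.pi_pos
  calc _ ≤ (2 * Real.pi)⁻¹ * (Real.exp (Real.cosh 1) * Real.exp (-n) *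
        |Real.pi - -Real.pi|) := by
        gcongr
        exact (Complex.abs_re_le_norm _).trans hle
    _ = _ := by
        rw [abs_of_pos (by linarith)]
        field_simp
        ring

/-! ### Heat kernels in dimension d. -/

/-- Replacing one factor at a time costs a relative error ε each. It is used with ε = t⁻¹ to pass
from dimension one to dimension d. -/
theorem abs_prod_sub_prod_le {ι : Type*} (s : Finset ι) {a b A : ι → ℝ} {ε : ℝ}
    (ha : ∀ i ∈ s, |a i| ≤ A i) (hb : ∀ i ∈ s, |b i| ≤ A i)
    (hab : ∀ i ∈ s, |a i - b i| ≤ ε * A i) :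
    |∏ i ∈ s, a i - ∏ i ∈ s, b i| ≤ s.card * ε * ∏ i ∈ s, A i := by
  classical
  induction s using Finset.induction_on with
  | empty => simp
  | insert i s hi ih =>
    rw [Finset.prod_insert hi, Finset.prod_insert hi, Finset.prod_insert hi,
      Finset.card_insert_of_notMem hi]
    have h1 := ih (fun j hj => ha j (Finset.mem_insert_of_mem hj))
      (fun j hj => hb j (Finset.mem_insert_of_mem hj))
      (fun j hj => hab j (Finset.mem_insert_of_mem hj))
    have h2 : |∏ j ∈ s, a j| ≤ ∏ j ∈ s, A j := by
      rw [Finset.abs_prod]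
      exact Finset.prod_le_prod (fun _ _ => abs_nonneg _)
        fun j hj => ha j (Finset.mem_insert_of_mem hj)
    have h3 := hab i (Finset.mem_insert_self i s)
    have h4 := hb i (Finset.mem_insert_self i s)
    calc |a i * ∏ j ∈ s, a j - b i * ∏ j ∈ s, b j|
        = |(a i - b i) * ∏ j ∈ s, a j + b i * (∏ j ∈ s, a j - ∏ j ∈ s, b j)| := by
          congr 1; ring
      _ ≤ |a i - b i| * |∏ j ∈ s, a j| + |b i| * |∏ j ∈ s, a j - ∏ j ∈ s, b j| := by
          refine (abs_add_le _ _).trans ?_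
          rw [abs_mul, abs_mul]
      _ ≤ (ε * A i) * ∏ j ∈ s, A j + A i * (s.card * ε * ∏ j ∈ s, A j) := by
          have h5 := (abs_nonneg _).trans h3
          have h6 := (abs_nonneg _).trans h4
          gcongr
      _ = _ := by push_cast; ring

/-- The heat kernel of a continuous-time simple random walk on `ℤ^d`. -/
def heat (t : ℝ) (x : Lattice d) : ℝ := ∏ i, kern t (x i)

/-- The heat kernel of Brownian motion on `ℝ^d` at distance `R`. -/
def radialGauss (d : ℕ) (t R : ℝ) : ℝ :=
  (2 * Real.pi * t) ^ (-(d / 2 : ℝ)) * Real.exp (-(R ^ 2 / (2 * t)))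

theorem euclNorm_sq (x : Lattice d) : euclNorm x ^ 2 = ∑ i, (x i : ℝ) ^ 2 :=
  Real.sq_sqrt (Finset.sum_nonneg fun _ _ => sq_nonneg _)

theorem euclNorm_nonneg (x : Lattice d) : 0 ≤ euclNorm x := Real.sqrt_nonneg _

theorem one_le_euclNorm {x : Lattice d} (hx : x ≠ 0) : 1 ≤ euclNorm x := by
  obtain ⟨i, hi⟩ := Function.ne_iff.1 hx
  have h1 : (1 : ℝ) ≤ (x i : ℝ) ^ 2 := by
    have : (1 : ℝ) ≤ |(x i : ℝ)| := by exact_mod_cast Int.one_le_abs hi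
    rw [← sq_abs]; nlinarith
  refine Real.one_le_sqrt.2 (h1.trans ?_)
  exact Finset.single_le_sum (f := fun i => (x i : ℝ) ^ 2) (fun _ _ => sq_nonneg _)
    (Finset.mem_univ i)

theorem euclNorm_le_sum (x : Lattice d) : euclNorm x ≤ ∑ i, |(x i : ℝ)| := by
  refine Real.sqrt_le_iff.2 ⟨Finset.sum_nonneg fun _ _ => abs_nonneg _, ?_⟩
  simpa using Finset.sum_sq_le_sq_sum_of_nonneg (s := Finset.univ)
    (f := fun i => |(x i : ℝ)|) fun _ _ => abs_nonneg _

theorem prod_gauss {t : ℝ} (ht : 0 < t) (x : Lattice d) :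
    ∏ i, gauss t (x i) = radialGauss d t (euclNorm x) := by
  unfold gauss radialGauss
  rw [Finset.prod_mul_distrib, Finset.prod_const, Finset.card_univ, Fintype.card_fin,
    ← Real.exp_sum, euclNorm_sq, ← Real.rpow_natCast, ← Real.rpow_mul (by positivity),
    Finset.sum_neg_distrib, ← Finset.sum_div]
  congr 2
  ring

theorem rpow_half_pow {t : ℝ} (ht : 0 < t) (d : ℕ) :
    (t ^ (-(1 / 2) : ℝ)) ^ d = t ^ (-(d / 2 : ℝ)) := by
  rw [← Real.rpow_natCast, ← Real.rpow_mul ht.le]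
  congr 1; ring

theorem prod_exp_le (x : Lattice d) {c : ℝ} (hc : 0 ≤ c) :
    ∏ i, Real.exp (-(|(x i : ℝ)| * c)) ≤ Real.exp (-(euclNorm x * c)) := by
  rw [← Real.exp_sum, Finset.sum_neg_distrib, ← Finset.sum_mul]
  have := euclNorm_le_sum x
  gcongr

/-- The local central limit theorem in dimension `d`. -/
theorem exists_heat_sub_radialGauss_le (d : ℕ) : ∃ C : ℝ, 0 ≤ C ∧ ∀ (t : ℝ) (x : Lattice d),
    1 ≤ t → |heat t x - radialGauss d t (euclNorm x)| ≤
      C * t ^ (-(d / 2 : ℝ) - 1) * Real.exp (-(euclNorm x / √t)) := by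
  obtain ⟨C₁, hC₁, h₁⟩ := exists_kern_sub_gauss_le
  obtain ⟨C₂, hC₂, h₂⟩ := exists_kern_le
  let C := C₁ + C₂ + Real.exp 1
  have hC : 0 ≤ C := by positivity
  have he := Real.exp_pos 1
  refine ⟨d * C ^ d, by positivity, fun t x ht => ?_⟩
  have ht0 : 0 < t := by linarith
  rw [← prod_gauss ht0]
  unfold heat
  have hpow : t ^ (-(3 / 2) : ℝ) = t⁻¹ * t ^ (-(1 / 2) : ℝ) := by
    rw [← Real.rpow_neg_one t, ← Real.rpow_add ht0]; norm_num
  have key := abs_prod_sub_prod_le Finset.univ (a := fun i => kern t (x i))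
    (b := fun i => gauss t (x i))
    (A := fun i => C * t ^ (-(1 / 2) : ℝ) * Real.exp (-(|(x i : ℝ)| / √t))) (ε := t⁻¹)
    (fun i _ => (h₂ t (x i) ht).trans (by gcongr; linarith))
    (fun i _ => by
      rw [abs_of_nonneg (gauss_nonneg ht0.le _)]
      exact (gauss_le ht0 _).trans (by gcongr; linarith))
    (fun i _ => by
      refine (h₁ t (x i) ht).trans ?_
      rw [hpow]
      calc C₁ * (t⁻¹ * t ^ (-(1 / 2) : ℝ)) * Real.exp (-(|(x i : ℝ)| / √t)) ≤
          C * (t⁻¹ * t ^ (-(1 / 2) : ℝ)) * Real.exp (-(|(x i : ℝ)| / √t)) := by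
            gcongr; linarith
        _ = _ := by ring)
  refine key.trans ?_
  rw [Finset.prod_mul_distrib, Finset.prod_const, Finset.card_univ, Fintype.card_fin, mul_pow,
    rpow_half_pow ht0, Real.rpow_sub_one ht0.ne']
  have h3 := prod_exp_le x (c := (√t)⁻¹) (by positivity)
  simp only [div_eq_mul_inv] at h3 ⊢
  calc _ ≤ d * t⁻¹ * (C ^ d * t ^ (-(d * 2⁻¹ : ℝ)) * Real.exp (-(euclNorm x * (√t)⁻¹))) := by
        gcongr
    _ = _ := by ring

theorem exists_heat_le_of_le_one (d : ℕ) : ∃ C : ℝ, 0 ≤ C ∧ ∀ (t : ℝ) (x : Lattice d),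
    0 ≤ t → t ≤ 1 → |heat t x| ≤ C * Real.exp (-euclNorm x) := by
  obtain ⟨C, hC, h⟩ := exists_kern_le_of_le_one
  refine ⟨C ^ d, by positivity, fun t x h0 h1 => ?_⟩
  unfold heat
  rw [Finset.abs_prod]
  have h2 := prod_exp_le x (c := 1) zero_le_one
  simp only [mul_one] at h2
  calc _ ≤ ∏ i, (C * Real.exp (-|(x i : ℝ)|)) :=
        Finset.prod_le_prod (fun _ _ => abs_nonneg _) fun i _ => h t (x i) h0 h1
    _ = C ^ d * ∏ i, Real.exp (-|(x i : ℝ)|) := by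
        rw [Finset.prod_mul_distrib, Finset.prod_const, Finset.card_univ, Fintype.card_fin]
    _ ≤ _ := by gcongr

theorem heat_zero (x : Lattice d) : heat 0 x = if x = 0 then 1 else 0 := by
  unfold heat
  simp only [kern_zero]
  split_ifs with h
  · subst h; simp
  · obtain ⟨i, hi⟩ := Function.ne_iff.1 h
    exact Finset.prod_eq_zero (Finset.mem_univ i) (by simpa using hi)

theorem heat_eq_prod_erase_mul (t : ℝ) (x y : Lattice d) (i : Fin d) (h : ∀ j, j ≠ i → y j = x j) :
    heat t y = (∏ j ∈ Finset.univ.erase i, kern t (x j)) * kern t (y i) := by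
  unfold heat
  rw [← Finset.prod_erase_mul _ _ (Finset.mem_univ i)]
  congr 1
  exact Finset.prod_congr rfl fun j hj => by rw [h j (Finset.ne_of_mem_erase hj)]

/-- Product rule. Each coordinate jumps at rate 1, so the total rate is d, whence the factor d. -/
theorem heat_hasDerivAt (hd : 0 < d) (t : ℝ) (x : Lattice d) :
    HasDerivAt (fun t => heat t x) (d * lap (heat t) x) t := by
  have h := HasDerivAt.fun_finsetProd (u := Finset.univ) (x := t)
    (f := fun (i : Fin d) t => kern t (x i)) fun i _ => kern_hasDerivAt t (x i)
  refine h.congr_deriv ?_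
  have hd' : (d : ℝ) ≠ 0 := by positivity
  have h1 : d * lap (heat t) x = ∑ i : Fin d,
      ((heat t (x + unitVec i) + heat t (x - unitVec i)) / 2 - heat t x) := by
    unfold lap nbrSum
    rw [Finset.sum_sub_distrib, ← Finset.sum_div, Finset.sum_const, Finset.card_univ,
      Fintype.card_fin, nsmul_eq_mul]
    field_simp
  rw [h1]
  refine Finset.sum_congr rfl fun i _ => ?_
  rw [heat_eq_prod_erase_mul t x x i (fun _ _ => rfl),
    heat_eq_prod_erase_mul t x (x + unitVec i) i (fun j hj => by simp [unitVec, hj]),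
    heat_eq_prod_erase_mul t x (x - unitVec i) i (fun j hj => by simp [unitVec, hj])]
  simp only [unitVec, Pi.add_apply, Pi.sub_apply, Pi.single_eq_same, smul_eq_mul]
  ring

theorem heat_continuous (hd : 0 < d) (x : Lattice d) : Continuous fun t => heat t x :=
  continuous_iff_continuousAt.2 fun t => (heat_hasDerivAt hd t x).continuousAt

/-! ### Time integrability of kernel differences. -/

theorem radialGauss_nonneg {t : ℝ} (ht : 0 ≤ t) (R : ℝ) : 0 ≤ radialGauss d t R := by
  unfold radialGauss; positivity

theorem rpow_two_pi_mul_le {t : ℝ} (ht : 0 < t) (d : ℕ) :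
    (2 * Real.pi * t) ^ (-(d / 2 : ℝ)) ≤ t ^ (-(d / 2 : ℝ)) := by
  apply Real.rpow_le_rpow_of_nonpos ht _ (by simp; positivity)
  nlinarith [Real.pi_gt_three]

theorem exp_neg_le {y : ℝ} (hy : 0 < y) (n : ℕ) : Real.exp (-y) ≤ n.factorial * (y ^ n)⁻¹ := by
  have h := Real.pow_div_factorial_le_exp y hy.le n
  rw [Real.exp_neg]
  have : 0 < y ^ n / n.factorial := by positivity
  calc (Real.exp y)⁻¹ ≤ (y ^ n / n.factorial)⁻¹ := by gcongr
    _ = _ := by rw [inv_div, div_eq_mul_inv]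

/-- Short times contribute little to the Brownian Green function. -/
theorem radialGauss_le_of_le_one {t R : ℝ} (h0 : 0 < t) (h1 : t ≤ 1) (hR : 0 < R) :
    radialGauss d t R ≤ ((d + 2).factorial * 2 ^ (d + 2)) * ((R ^ 2) ^ (d + 2))⁻¹ := by
  unfold radialGauss
  have h2 := exp_neg_le (y := R ^ 2 / (2 * t)) (by positivity) (d + 2)
  have h3 : t ^ (-(d / 2 : ℝ)) * t ^ (d + 2) ≤ 1 := by
    rw [← Real.rpow_natCast t (d + 2), ← Real.rpow_add h0]
    refine Real.rpow_le_one h0.le h1 ?_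
    push_cast
    have : (0 : ℝ) ≤ d := by positivity
    linarith
  calc _ ≤ t ^ (-(d / 2 : ℝ)) * ((d + 2).factorial * ((R ^ 2 / (2 * t)) ^ (d + 2))⁻¹) := by
        have := rpow_two_pi_mul_le h0 d
        exact mul_le_mul this h2 (by positivity) (by positivity)
    _ = (t ^ (-(d / 2 : ℝ)) * t ^ (d + 2)) *
        (((d + 2).factorial * 2 ^ (d + 2)) * ((R ^ 2) ^ (d + 2))⁻¹) := by
        rw [div_pow, mul_pow, inv_div]; field_simp
    _ ≤ 1 * (((d + 2).factorial * 2 ^ (d + 2)) * ((R ^ 2) ^ (d + 2))⁻¹) := by gcongr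
    _ = _ := one_mul _

theorem abs_radialGauss_sub_zero_le {t : ℝ} (ht : 0 < t) (R : ℝ) :
    |radialGauss d t R - radialGauss d t 0| ≤ R ^ 2 * t ^ (-(d / 2 : ℝ) - 1) := by
  unfold radialGauss
  have h1 : 1 - R ^ 2 / (2 * t) ≤ Real.exp (-(R ^ 2 / (2 * t))) := Real.one_sub_le_exp_neg _
  have h2 : Real.exp (-(R ^ 2 / (2 * t))) ≤ 1 := Real.exp_le_one_iff.2 (by simp; positivity)
  rw [← mul_sub, abs_mul, abs_of_nonneg (by positivity : 0 ≤ (2 * Real.pi * t) ^ (-(d / 2 : ℝ))),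
    Real.rpow_sub_one ht.ne']
  have h3 : |Real.exp (-(R ^ 2 / (2 * t))) - Real.exp (-(0 ^ 2 / (2 * t)))| ≤ R ^ 2 / t := by
    have : R ^ 2 / (2 * t) ≤ R ^ 2 / t := by
      gcongr; linarith
    simp only [ne_eq, OfNat.ofNat_ne_zero, not_false_eq_true, zero_pow, zero_div, neg_zero,
      Real.exp_zero]
    rw [abs_of_nonpos (by linarith)]
    linarith
  calc _ ≤ t ^ (-(d / 2 : ℝ)) * (R ^ 2 / t) := by
        exact mul_le_mul (rpow_two_pi_mul_le ht d) h3 (by positivity) (by positivity)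
    _ = _ := by ring

theorem radialGauss_measurable (d : ℕ) (R : ℝ) : Measurable fun t => radialGauss d t R := by
  unfold radialGauss; fun_prop

theorem integrableOn_of_le_one_of_one_le {f : ℝ → ℝ} {A B : ℝ} (hd : 0 < d) (hf : Measurable f)
    (h1 : ∀ t, 0 < t → t ≤ 1 → |f t| ≤ A)
    (h2 : ∀ t, 1 ≤ t → |f t| ≤ B * t ^ (-(d / 2 : ℝ) - 1)) :
    IntegrableOn f (Set.Ioi 0) := by
  rw [← Set.Ioc_union_Ioi_eq_Ioi zero_le_one, integrableOn_union]
  constructor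
  · refine Measure.integrableOn_of_bounded (M := A) (by simp) hf.aestronglyMeasurable ?_
    exact (ae_restrict_iff' measurableSet_Ioc).2 (Eventually.of_forall fun t ht => h1 t ht.1 ht.2)
  · have hd' : (0 : ℝ) < d := by positivity
    refine Integrable.mono' ((integrableOn_Ioi_rpow_of_lt (a := -(d / 2 : ℝ) - 1)
      (by linarith) one_pos).const_mul B) hf.aestronglyMeasurable ?_
    exact (ae_restrict_iff' measurableSet_Ioi).2
      (Eventually.of_forall fun t ht => h2 t (le_of_lt ht))

theorem exists_radialGauss_sub_heat_le (d : ℕ) (R : ℝ) : ∃ B : ℝ, ∀ t, 1 ≤ t →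
    |radialGauss d t R - heat t (0 : Lattice d)| ≤ B * t ^ (-(d / 2 : ℝ) - 1) := by
  obtain ⟨C, hC, h⟩ := exists_heat_sub_radialGauss_le d
  refine ⟨R ^ 2 + C, fun t ht => ?_⟩
  have h1 := abs_radialGauss_sub_zero_le (d := d) (by linarith : 0 < t) R
  have h2 := h t 0 ht
  have h0 : euclNorm (0 : Lattice d) = 0 := by simp [euclNorm]
  rw [h0, zero_div, neg_zero, Real.exp_zero, mul_one, abs_sub_comm] at h2
  have := abs_sub_le (radialGauss d t R) (radialGauss d t 0) (heat t (0 : Lattice d))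
  linarith

theorem heat_sub_integrable (hd : 0 < d) (x : Lattice d) :
    IntegrableOn (fun t => heat t x - heat t (0 : Lattice d)) (Set.Ioi 0) := by
  obtain ⟨C, hC, h⟩ := exists_heat_sub_radialGauss_le d
  obtain ⟨B, hB⟩ := exists_radialGauss_sub_heat_le d (euclNorm x)
  obtain ⟨D, hD, h'⟩ := exists_heat_le_of_le_one d
  refine integrableOn_of_le_one_of_one_le (A := D + D) (B := C + B) hd
    ((heat_continuous hd x).sub (heat_continuous hd 0)).measurable (fun t h0 h1 => ?_)
    fun t ht => ?_
  · refine (abs_sub _ _).trans (add_le_add ((h' t x h0.le h1).trans ?_)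
      ((h' t 0 h0.le h1).trans ?_)) <;>
    exact mul_le_of_le_one_right hD (Real.exp_le_one_iff.2 (by simpa using euclNorm_nonneg _))
  · have h1 : C * t ^ (-(d / 2 : ℝ) - 1) * Real.exp (-(euclNorm x / √t)) ≤
        C * t ^ (-(d / 2 : ℝ) - 1) := by
      refine mul_le_of_le_one_right (by positivity) (Real.exp_le_one_iff.2 ?_)
      have := euclNorm_nonneg x
      simp; positivity
    have := abs_sub_le (heat t x) (radialGauss d t (euclNorm x))
      (heat t (0 : Lattice d))
    linarith [h t x ht, hB t ht]

theorem radialGauss_sub_integrable (hd : 0 < d) {R : ℝ} (hR : 0 < R) :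
    IntegrableOn (fun t => radialGauss d t R - heat t (0 : Lattice d)) (Set.Ioi 0) := by
  obtain ⟨B, hB⟩ := exists_radialGauss_sub_heat_le d R
  obtain ⟨D, hD, h'⟩ := exists_heat_le_of_le_one d
  refine integrableOn_of_le_one_of_one_le
    (A := ((d + 2).factorial * 2 ^ (d + 2)) * ((R ^ 2) ^ (d + 2))⁻¹ + D) (B := B) hd
    ((radialGauss_measurable d R).sub (heat_continuous hd 0).measurable) (fun t h0 h1 => ?_) hB
  refine (abs_sub _ _).trans (add_le_add ?_ ((h' t 0 h0.le h1).trans ?_))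
  · rw [abs_of_nonneg (radialGauss_nonneg h0.le R)]
    exact radialGauss_le_of_le_one h0 h1 hR
  · exact mul_le_of_le_one_right hD (Real.exp_le_one_iff.2 (by simpa using euclNorm_nonneg _))

theorem heat_tendsto_zero (hd : 0 < d) (x : Lattice d) :
    Tendsto (fun t => heat t x) atTop (𝓝 0) := by
  obtain ⟨C, hC, h⟩ := exists_kern_le
  have hd' : (0 : ℝ) < d := by positivity
  have h1 : Tendsto (fun t : ℝ => C ^ d * t ^ (-(d / 2 : ℝ))) atTop (𝓝 0) := by
    simpa using (tendsto_rpow_neg_atTop (y := (d / 2 : ℝ)) (by positivity)).const_mul (C ^ d)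
  refine squeeze_zero_norm' ?_ h1
  filter_upwards [eventually_ge_atTop 1] with t ht
  unfold heat
  rw [Real.norm_eq_abs, Finset.abs_prod]
  calc _ ≤ ∏ _i : Fin d, (C * t ^ (-(1 / 2) : ℝ)) := by
        refine Finset.prod_le_prod (fun _ _ => abs_nonneg _) fun i _ => (h t (x i) ht).trans ?_
        refine mul_le_of_le_one_right (by positivity) (Real.exp_le_one_iff.2 ?_)
        simp; positivity
    _ = _ := by
        rw [Finset.prod_const, Finset.card_univ, Fintype.card_fin, mul_pow,
          rpow_half_pow (by linarith)]

/-! ### The lattice Green function and its radial approximation. -/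

/-- The (renormalized) Green function of the lattice, vanishing at the origin. -/
def green (x : Lattice d) : ℝ := d * ∫ t in Set.Ioi (0 : ℝ), (heat t x - heat t (0 : Lattice d))

/-- The integrand d Δ(heat) is a time derivative, so the integral is the limit of `heat` at infinity
minus its value δ₀ at time 0. Subtracting the value at the origin makes the defining integral
converge even for d = 2. -/
theorem lap_green (hd : 0 < d) (x : Lattice d) : lap green x = -(if x = 0 then 1 else 0) := by
  have hi := heat_sub_integrable hd
  have h1 : lap green x = ∫ t in Set.Ioi (0 : ℝ), d * lap (heat t) x := by
    have h2 : nbrSum green x = d * ∫ t in Set.Ioi (0 : ℝ),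
        nbrSum (fun y => heat t y - heat t (0 : Lattice d)) x := by
      unfold nbrSum green
      have h := integral_finsetSum (μ := volume.restrict (Set.Ioi (0 : ℝ))) Finset.univ
        (f := fun (i : Fin d) t => (heat t (x + unitVec i) - heat t (0 : Lattice d)) +
          (heat t (x - unitVec i) - heat t (0 : Lattice d))) fun i _ => (hi _).add (hi _)
      rw [h, Finset.mul_sum]
      exact Finset.sum_congr rfl fun i _ => by rw [integral_add (hi _) (hi _)]; ring
    have h3 : IntegrableOn (fun t => nbrSum (fun y => heat t y - heat t (0 : Lattice d)) x / (2 * d))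
        (Set.Ioi 0) :=
      (integrable_finsetSum _ fun i _ => (hi _).add (hi _)).div_const _
    have h4 : ∀ t, d * lap (heat t) x = d * (nbrSum (fun y => heat t y - heat t (0 : Lattice d)) x / (2 * d) -
        (heat t x - heat t (0 : Lattice d))) := by
      intro t
      have := lap_sub (heat t) (fun _ => heat t (0 : Lattice d)) x
      rw [lap_const hd, sub_zero] at this
      rw [← this]
      rfl
    simp only [h4]
    rw [integral_const_mul, integral_sub h3 (hi x), integral_div, lap, h2]
    unfold green
    ring
  have hint : IntegrableOn (fun t => d * lap (heat t) x) (Set.Ioi 0) := by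
    have h3 : IntegrableOn (fun t => nbrSum (fun y => heat t y - heat t (0 : Lattice d)) x / (2 * d))
        (Set.Ioi 0) :=
      (integrable_finsetSum _ fun i _ => (hi _).add (hi _)).div_const _
    refine ((h3.sub (hi x)).const_mul (d : ℝ)).congr (Eventually.of_forall fun t => ?_)
    have := lap_sub (heat t) (fun _ => heat t (0 : Lattice d)) x
    rw [lap_const hd, sub_zero] at this
    simp only [← this]
    rfl
  rw [h1, integral_Ioi_of_hasDerivAt_of_tendsto
    (heat_continuous hd x).continuousWithinAt (fun t _ => heat_hasDerivAt hd t x) hint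
    (heat_tendsto_zero hd x), heat_zero, zero_sub]

/-- The radial function to which the lattice Green function is asymptotic. -/
def potential (d : ℕ) (R : ℝ) : ℝ :=
  d * ∫ t in Set.Ioi (0 : ℝ), (radialGauss d t R - heat t (0 : Lattice d))

theorem unitBallVolume_eq (hd : 0 < d) :
    unitBallVolume d = √Real.pi ^ d / Real.Gamma (d / 2 + 1) := by
  have : Nonempty (Fin d) := ⟨⟨0, hd⟩⟩
  have hG : 0 < Real.Gamma (d / 2 + 1) := Real.Gamma_pos_of_pos (by positivity)
  unfold unitBallVolume
  rw [EuclideanSpace.volume_ball]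
  simp only [ENNReal.ofReal_one, one_pow, one_mul, Fintype.card_fin]
  exact ENNReal.toReal_ofReal (by positivity)

theorem unitBallVolume_pos (hd : 0 < d) : 0 < unitBallVolume d := by
  rw [unitBallVolume_eq hd]
  have hG : 0 < Real.Gamma (d / 2 + 1) := Real.Gamma_pos_of_pos (by positivity)
  have := Real.pi_pos
  positivity

/-- The substitution t ↦ 1/t turns this into a Gamma integral. -/
theorem integral_inv_mul_radialGauss (hd : 0 < d) {R : ℝ} (hR : 0 < R) :
    ∫ t in Set.Ioi (0 : ℝ), t⁻¹ * radialGauss d t R = Real.Gamma (d / 2) / (√Real.pi * R) ^ d := by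
  have hd' : (0 : ℝ) < d := by positivity
  have hpi := Real.pi_pos
  have h1 := integral_comp_rpow_Ioi
    (fun y : ℝ => y ^ ((d / 2 : ℝ) - 1) * Real.exp (-(R ^ 2 / 2 * y))) (p := -1) (by norm_num)
  rw [Real.integral_rpow_mul_exp_neg_mul_Ioi (by positivity) (by positivity)] at h1
  have h2 : ∀ t ∈ Set.Ioi (0 : ℝ), t⁻¹ * radialGauss d t R = (2 * Real.pi) ^ (-(d / 2 : ℝ)) *
      ((|(-1)| * t ^ ((-1 : ℝ) - 1)) •
        ((t ^ (-1 : ℝ)) ^ ((d / 2 : ℝ) - 1) * Real.exp (-(R ^ 2 / 2 * t ^ (-1 : ℝ))))) := by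
    intro t ht
    have ht0 : 0 < t := ht
    have h3 : t ^ ((-1 : ℝ) - 1) * (t ^ (-1 : ℝ)) ^ ((d / 2 : ℝ) - 1) =
        t⁻¹ * t ^ (-(d / 2 : ℝ)) := by
      rw [← Real.rpow_mul ht0.le, ← Real.rpow_add ht0, ← Real.rpow_neg_one t,
        ← Real.rpow_add ht0]
      congr 1; ring
    have h4 : R ^ 2 / 2 * t ^ (-1 : ℝ) = R ^ 2 / (2 * t) := by
      rw [Real.rpow_neg_one]; field_simp
    unfold radialGauss
    rw [h4, Real.mul_rpow (by positivity) ht0.le, smul_eq_mul, abs_neg, abs_one, one_mul,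
      ← mul_assoc (t ^ ((-1 : ℝ) - 1)), h3]
    ring
  rw [setIntegral_congr_fun measurableSet_Ioi h2, integral_const_mul, h1]
  have h5 : (√Real.pi * R) ^ d = (Real.pi * R ^ 2) ^ (d / 2 : ℝ) := by
    rw [show Real.pi * R ^ 2 = (√Real.pi * R) ^ (2 : ℝ) by
        rw [Real.rpow_two, mul_pow, Real.sq_sqrt hpi.le],
      ← Real.rpow_mul (by positivity), ← Real.rpow_natCast]
    congr 1; ring
  rw [h5, Real.rpow_neg (by positivity), ← Real.inv_rpow (by positivity), ← mul_assoc,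
    ← Real.mul_rpow (by positivity) (by positivity),
    show (2 * Real.pi)⁻¹ * (1 / (R ^ 2 / 2)) = (Real.pi * R ^ 2)⁻¹ by field_simp,
    Real.inv_rpow (by positivity)]
  field_simp

theorem inv_mul_radialGauss_integrable (hd : 0 < d) {R : ℝ} (hR : 0 < R) :
    IntegrableOn (fun t => t⁻¹ * radialGauss d t R) (Set.Ioi 0) := by
  -- Non-integrable functions have Bochner integral 0 by convention, so a nonzero value proves
  -- integrability.
  refine Integrable.of_integral_ne_zero ?_
  rw [integral_inv_mul_radialGauss hd hR]
  have hG : 0 < Real.Gamma (d / 2) := Real.Gamma_pos_of_pos (by positivity)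
  have := Real.pi_pos
  positivity

theorem radialGauss_hasDerivAt {t : ℝ} (ht : 0 < t) (R : ℝ) :
    HasDerivAt (fun R => radialGauss d t R) (-(R * (t⁻¹ * radialGauss d t R))) R := by
  unfold radialGauss
  have h1 : HasDerivAt (fun R : ℝ => -(R ^ 2 / (2 * t))) (-(R / t)) R := by
    refine ((hasDerivAt_pow 2 R).div_const (2 * t)).fun_neg.congr_deriv ?_
    field_simp
    norm_num
  refine (h1.exp.const_mul _).congr_deriv ?_
  ring

theorem radialGauss_anti {t R R' : ℝ} (ht : 0 < t) (hR : 0 ≤ R) (hRR' : R ≤ R') :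
    radialGauss d t R' ≤ radialGauss d t R := by
  unfold radialGauss
  gcongr

/-- The heat kernel at the origin enters `potential` only as an additive constant, so it disappears
here and the derivative is explicit. -/
theorem potential_hasDerivAt (hd : 0 < d) {R : ℝ} (hR : 0 < R) :
    HasDerivAt (potential d) (-(2 / unitBallVolume d * (R / R ^ d))) R := by
  have hmeas := (heat_continuous hd (0 : Lattice d)).measurable
  have h := (hasDerivAt_integral_of_dominated_loc_of_deriv_le
    (μ := volume.restrict (Set.Ioi (0 : ℝ))) (𝕜 := ℝ)
    (F := fun R t => radialGauss d t R - heat t (0 : Lattice d))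
    (F' := fun R t => -(R * (t⁻¹ * radialGauss d t R)))
    (bound := fun t => 2 * R * (t⁻¹ * radialGauss d t (R / 2))) (x₀ := R)
    (s := Set.Ioo (R / 2) (2 * R))
    (Ioo_mem_nhds (by linarith) (by linarith))
    (Eventually.of_forall fun S =>
      ((radialGauss_measurable d S).sub hmeas).aestronglyMeasurable)
    (radialGauss_sub_integrable hd hR)
    (((measurable_inv.mul (radialGauss_measurable d R)).const_mul R).neg.aestronglyMeasurable)
    ((ae_restrict_iff' measurableSet_Ioi).2 (Eventually.of_forall fun t ht S hS => by
      have ht0 : 0 < t := ht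
      have h1 := radialGauss_anti (d := d) ht0 (by positivity : 0 ≤ R / 2) hS.1.le
      have h2 := radialGauss_nonneg (d := d) ht0.le S
      have h3 : 0 < S := by linarith [hS.1]
      rw [norm_neg, Real.norm_of_nonneg (by positivity)]
      have := hS.2.le
      gcongr))
    ((inv_mul_radialGauss_integrable hd (by positivity)).const_mul _)
    ((ae_restrict_iff' measurableSet_Ioi).2 (Eventually.of_forall fun t ht S _ =>
      (radialGauss_hasDerivAt ht S).sub_const _))).2
  refine (h.const_mul (d : ℝ)).congr_deriv ?_
  rw [integral_neg, integral_const_mul, integral_inv_mul_radialGauss hd hR, unitBallVolume_eq hd,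
    Real.Gamma_add_one (by positivity)]
  have hG : 0 < Real.Gamma (d / 2) := Real.Gamma_pos_of_pos (by positivity)
  have := Real.pi_pos
  field_simp
  rw [mul_pow]; ring

/-- The lattice Green function is radial up to an error `O(|x|^{-d})`. -/
theorem exists_green_sub_potential_le (hd : 0 < d) : ∃ C : ℝ, 0 ≤ C ∧ ∀ x : Lattice d, x ≠ 0 →
    |green x - potential d (euclNorm x)| ≤ C * (euclNorm x ^ d)⁻¹ := by
  obtain ⟨C, hC, h⟩ := exists_heat_sub_radialGauss_le d
  obtain ⟨D, hD, h'⟩ := exists_heat_le_of_le_one d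
  let M : ℝ := C * (d + 2).factorial + (D * (d + 2).factorial + (d + 2).factorial * 2 ^ (d + 2))
  have hM : 0 ≤ M := by positivity
  have hd' : (0 : ℝ) < d := by positivity
  refine ⟨d * (M + C * (2 / d)), by positivity, fun x hx => ?_⟩
  have hR := one_le_euclNorm hx
  set R := euclNorm x with hRdef
  have hR0 : 0 < R := by linarith
  have hpos : 0 ≤ (R ^ (d + 2))⁻¹ := by positivity
  have hI1 := heat_sub_integrable hd x
  have hI2 := radialGauss_sub_integrable hd hR0
  have hI : IntegrableOn (fun t => heat t x - radialGauss d t R) (Set.Ioi 0) := by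
    refine (hI1.sub hI2).congr (Eventually.of_forall fun t => ?_)
    simp
  -- Integrated over t ≤ R², this bound of order R^{-d-2} gives R^{-d}, the same order as the tail t
  -- > R².
  have hsmall : ∀ t, 0 < t → |heat t x - radialGauss d t R| ≤ M * (R ^ (d + 2))⁻¹ := by
    intro t ht
    rcases le_total t 1 with h1 | h1
    · have h2 := h' t x ht.le h1
      have h3 := exp_neg_le hR0 (d + 2)
      have h4 := radialGauss_le_of_le_one (d := d) ht h1 hR0
      have h5 : ((R ^ 2) ^ (d + 2))⁻¹ ≤ (R ^ (d + 2))⁻¹ := by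
        gcongr
        nlinarith
      have h6 := radialGauss_nonneg (d := d) ht.le R
      calc _ ≤ |heat t x| + |radialGauss d t R| := abs_sub _ _
        _ ≤ D * ((d + 2).factorial * (R ^ (d + 2))⁻¹) +
            ((d + 2).factorial * 2 ^ (d + 2)) * (R ^ (d + 2))⁻¹ := by
          rw [abs_of_nonneg h6]
          refine add_le_add (h2.trans ?_) (h4.trans ?_) <;> gcongr
        _ = (M - C * (d + 2).factorial) * (R ^ (d + 2))⁻¹ := by ring
        _ ≤ _ := by
          refine mul_le_mul_of_nonneg_right ?_ hpos
          have : 0 ≤ C * (d + 2).factorial := by positivity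
          linarith
    -- The power d + 2 exactly cancels t^{-d/2-1}.
    · have h2 := exp_neg_le (y := R / √t) (by positivity) (d + 2)
      have h3 : t ^ (-(d / 2 : ℝ) - 1) * √t ^ (d + 2) = 1 := by
        rw [Real.sqrt_eq_rpow, ← Real.rpow_natCast, ← Real.rpow_mul ht.le, ← Real.rpow_add ht]
        push_cast
        rw [show -(d / 2 : ℝ) - 1 + 1 / 2 * (d + 2) = 0 by ring, Real.rpow_zero]
      calc _ ≤ C * t ^ (-(d / 2 : ℝ) - 1) * Real.exp (-(R / √t)) := h t x h1
        _ ≤ C * t ^ (-(d / 2 : ℝ) - 1) * ((d + 2).factorial * ((R / √t) ^ (d + 2))⁻¹) := by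
          gcongr
        _ = C * (d + 2).factorial * (t ^ (-(d / 2 : ℝ) - 1) * √t ^ (d + 2)) *
            (R ^ (d + 2))⁻¹ := by
          rw [div_pow, inv_div]; ring
        _ ≤ M * (R ^ (d + 2))⁻¹ := by
          rw [h3, mul_one]
          refine mul_le_mul_of_nonneg_right ?_ hpos
          have : 0 ≤ D * (d + 2).factorial + (d + 2).factorial * 2 ^ (d + 2) := by positivity
          linarith
  have hlarge : ∀ t, R ^ 2 < t → |heat t x - radialGauss d t R| ≤
      C * t ^ (-(d / 2 : ℝ) - 1) := by
    intro t ht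
    have h1 : 1 ≤ t := by nlinarith
    refine (h t x h1).trans (mul_le_of_le_one_right (by positivity) (Real.exp_le_one_iff.2 ?_))
    simp; positivity
  have hgreen : green x - potential d R =
      d * ∫ t in Set.Ioi (0 : ℝ), (heat t x - radialGauss d t R) := by
    unfold green potential
    rw [← mul_sub, ← integral_sub hI1 hI2]
    congr 2
    funext t
    ring
  have hR2 : 0 < R ^ 2 := by positivity
  have hsplit := Set.Ioc_union_Ioi_eq_Ioi hR2.le
  have hI' := hI
  rw [← hsplit, integrableOn_union] at hI'
  have hint1 : |∫ t in Set.Ioc 0 (R ^ 2), (heat t x - radialGauss d t R)| ≤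
      M * (R ^ d)⁻¹ := by
    have h1 := norm_setIntegral_le_of_norm_le_const (μ := volume) (s := Set.Ioc 0 (R ^ 2))
      (f := fun t => heat t x - radialGauss d t R) (C := M * (R ^ (d + 2))⁻¹) (by simp)
      (fun t ht => hsmall t ht.1)
    rw [Real.norm_eq_abs, Real.volume_real_Ioc_of_le hR2.le, sub_zero] at h1
    refine h1.trans_eq ?_
    rw [pow_add]
    field_simp
  have hint2 : |∫ t in Set.Ioi (R ^ 2), (heat t x - radialGauss d t R)| ≤
      C * (2 / d) * (R ^ d)⁻¹ := by
    have h1 := norm_integral_le_of_norm_le (μ := volume.restrict (Set.Ioi (R ^ 2)))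
      (f := fun t => heat t x - radialGauss d t R)
      ((integrableOn_Ioi_rpow_of_lt (a := -(d / 2 : ℝ) - 1) (by linarith) hR2).const_mul C)
      ((ae_restrict_iff' measurableSet_Ioi).2 (Eventually.of_forall fun t ht => hlarge t ht))
    rw [integral_const_mul, integral_Ioi_rpow_of_lt (by linarith) hR2] at h1
    refine h1.trans_eq ?_
    have h2 : (R ^ 2) ^ (-(d / 2 : ℝ) - 1 + 1) = (R ^ d)⁻¹ := by
      rw [sub_add_cancel, Real.rpow_neg (by positivity), ← Real.rpow_natCast R 2,
        ← Real.rpow_mul hR0.le, ← Real.rpow_natCast R d]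
      congr 2
      push_cast; ring
    rw [h2, sub_add_cancel, neg_div_neg_eq]
    field_simp
  rw [hgreen, ← hsplit, setIntegral_union (Set.Ioc_disjoint_Ioi le_rfl) measurableSet_Ioi
    hI'.1 hI'.2, abs_mul, abs_of_pos hd', mul_assoc]
  refine mul_le_mul_of_nonneg_left ((abs_add_le _ _).trans ?_) hd'.le
  linarith

/-! ### The Euclidean norm on the lattice. -/

theorem euclNorm_eq_norm (x : Lattice d) :
    euclNorm x = ‖(WithLp.toLp 2 (fun i => (x i : ℝ)) : EuclideanSpace ℝ (Fin d))‖ := by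
  rw [EuclideanSpace.norm_eq]
  simp [euclNorm]

theorem euclNorm_add_le (x y : Lattice d) : euclNorm (x + y) ≤ euclNorm x + euclNorm y := by
  rw [euclNorm_eq_norm, euclNorm_eq_norm, euclNorm_eq_norm]
  refine le_trans (le_of_eq ?_) (norm_add_le _ _)
  congr 1
  ext i
  simp

theorem euclNorm_neg (x : Lattice d) : euclNorm (-x) = euclNorm x := by
  simp [euclNorm]

theorem euclNorm_unitVec (i : Fin d) : euclNorm (unitVec i : Lattice d) = 1 := by
  unfold euclNorm
  rw [Finset.sum_eq_single i]
  · simp [unitVec]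
  · intro j _ hj; simp [unitVec, hj]
  · simp

theorem Adj.euclNorm_sub_le {x y : Lattice d} (h : Adj x y) (a : Lattice d) :
    euclNorm (y - a) ≤ euclNorm (x - a) + 1 := by
  obtain ⟨i, rfl | rfl⟩ := h.exists_unitVec
  · have := euclNorm_add_le (x - a) (unitVec i)
    rw [euclNorm_unitVec] at this
    rwa [add_sub_right_comm]
  · have := euclNorm_add_le (x - a) (-unitVec i)
    rw [euclNorm_neg, euclNorm_unitVec] at this
    rwa [sub_right_comm, sub_eq_add_neg (x - a)]

theorem Adj.euclNorm_le {x y : Lattice d} (h : Adj x y) : euclNorm y ≤ euclNorm x + 1 := by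
  simpa using h.euclNorm_sub_le 0

theorem abs_apply_le_euclNorm (x : Lattice d) (i : Fin d) : |(x i : ℝ)| ≤ euclNorm x := by
  refine Real.abs_le_sqrt ?_
  exact Finset.single_le_sum (f := fun i => (x i : ℝ) ^ 2) (fun _ _ => sq_nonneg _)
    (Finset.mem_univ i)

theorem finite_euclNorm_lt (a : Lattice d) (R : ℝ) :
    {x : Lattice d | euclNorm (x - a) < R}.Finite := by
  refine (Set.finite_Icc (fun i => a i - ⌈R⌉) (fun i => a i + ⌈R⌉)).subset fun x hx => ?_
  have h : ∀ i, |x i - a i| ≤ ⌈R⌉ := by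
    intro i
    have h1 := abs_apply_le_euclNorm (x - a) i
    have h2 : |((x i - a i : ℤ) : ℝ)| ≤ (⌈R⌉ : ℝ) :=
      (h1.trans (le_of_lt hx)).trans (Int.le_ceil R)
    exact_mod_cast h2
  constructor <;> intro i <;> have := abs_le.1 (h i) <;> simp only <;> linarith

theorem lap_euclNorm_sq (hd : 0 < d) (a x : Lattice d) :
    lap (fun y => euclNorm (y - a) ^ 2) x = 1 := by
  have hd' : (d : ℝ) ≠ 0 := by positivity
  have h : ∀ i : Fin d, euclNorm (x + unitVec i - a) ^ 2 + euclNorm (x - unitVec i - a) ^ 2 =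
      2 * euclNorm (x - a) ^ 2 + 2 := by
    intro i
    have h1 : (1 : ℝ) = ∑ j, ((unitVec i : Lattice d) j : ℝ) ^ 2 := by
      rw [← euclNorm_sq, euclNorm_unitVec]; norm_num
    simp only [euclNorm_sq]
    rw [show ∀ b : ℝ, 2 * b + 2 = 2 * b + 2 * 1 from fun b => by ring, h1, Finset.mul_sum, Finset.mul_sum, ← Finset.sum_add_distrib, ← Finset.sum_add_distrib]
    refine Finset.sum_congr rfl fun j _ => ?_
    simp only [Pi.add_apply, Pi.sub_apply]
    push_cast
    ring
  unfold lap nbrSum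
  simp only [h, Finset.sum_const, Finset.card_univ, Fintype.card_fin, nsmul_eq_mul]
  field_simp
  ring

/-! ### The radial profile and the obstacle. -/

/-- The radial profile `t ^ 2 + ω_d ρ ^ d Ψ(t)` of the obstacle; its minimum is at `t = ρ`. -/
def profile (d : ℕ) (ρ t : ℝ) : ℝ := t ^ 2 + unitBallVolume d * ρ ^ d * potential d t

theorem profile_hasDerivAt (hd : 0 < d) (ρ : ℝ) {t : ℝ} (ht : 0 < t) :
    HasDerivAt (profile d ρ) (2 * t * (1 - (ρ / t) ^ d)) t := by
  have hω := unitBallVolume_pos hd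
  refine ((hasDerivAt_pow 2 t).add ((potential_hasDerivAt hd ht).const_mul _)).congr_deriv ?_
  rw [div_pow]
  field_simp
  norm_num
  ring

/-- By Bernoulli's inequality the slope at s is at most 2d(s - ρ) ≤ 4d, on an interval of length at
most 2. -/
theorem profile_sub_le (hd : 0 < d) {ρ t : ℝ} (hρ : 0 < ρ) (h1 : ρ ≤ t) (h2 : t ≤ ρ + 2) :
    profile d ρ t - profile d ρ ρ ≤ 8 * d := by
  have hder : ∀ s ∈ Set.Icc ρ t, HasDerivAt (profile d ρ) (2 * s * (1 - (ρ / s) ^ d)) s :=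
    fun s hs => profile_hasDerivAt hd ρ (hρ.trans_le hs.1)
  have h := Convex.image_sub_le_mul_sub_of_deriv_le (convex_Icc ρ t) (f := profile d ρ)
    (C := 4 * d) (fun s hs => (hder s hs).continuousAt.continuousWithinAt)
    (fun s hs => (hder s (interior_subset hs)).differentiableAt.differentiableWithinAt)
    (fun s hs => by
      have hs' := interior_subset hs
      have hs0 : 0 < s := hρ.trans_le hs'.1
      rw [(hder s hs').deriv]
      have hb := one_add_mul_le_pow (a := ρ / s - 1) (by
        have : 0 ≤ ρ / s := by positivity
        linarith) d
      rw [add_sub_cancel] at hb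
      calc 2 * s * (1 - (ρ / s) ^ d) ≤ 2 * s * (d * (1 - ρ / s)) := by
            gcongr; linarith
        _ = 2 * d * (s - ρ) := by field_simp
        _ ≤ 2 * d * 2 := by
            have := hs'.2
            gcongr; linarith
        _ = _ := by ring)
    ρ ⟨le_rfl, h1⟩ t ⟨h1, le_rfl⟩ h1
  have : (4 * d : ℝ) * (t - ρ) ≤ 4 * d * 2 := by gcongr; linarith
  linarith

theorem profile_ge_of_ge (hd : 0 < d) {ρ t : ℝ} (hρ : 0 < ρ) (h1 : ρ ≤ t) :
    profile d ρ ρ ≤ profile d ρ t := by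
  have hder : ∀ s ∈ Set.Icc ρ t, HasDerivAt (profile d ρ) (2 * s * (1 - (ρ / s) ^ d)) s :=
    fun s hs => profile_hasDerivAt hd ρ (hρ.trans_le hs.1)
  refine monotoneOn_of_deriv_nonneg (convex_Icc ρ t)
    (fun s hs => (hder s hs).continuousAt.continuousWithinAt)
    (fun s hs => (hder s (interior_subset hs)).differentiableAt.differentiableWithinAt)
    (fun s hs => ?_) ⟨le_rfl, h1⟩ ⟨h1, le_rfl⟩ h1
  have hs' := interior_subset hs
  have hs0 : 0 < s := hρ.trans_le hs'.1
  rw [(hder s hs').deriv]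
  have : (ρ / s) ^ d ≤ 1 := pow_le_one₀ (by positivity) ((div_le_one hs0).2 hs'.1)
  exact mul_nonneg (by positivity) (by linarith)

/-- For s ≤ ρ, (ρ/s)^d ≥ ρ/s, so the slope is at most that of (ρ - s)². -/
theorem profile_ge_of_le (hd : 0 < d) {ρ t : ℝ} (ht : 0 < t) (h1 : t ≤ ρ) :
    (ρ - t) ^ 2 ≤ profile d ρ t - profile d ρ ρ := by
  have hder : ∀ s ∈ Set.Icc t ρ, HasDerivAt (fun s => profile d ρ s - (ρ - s) ^ 2)
      (2 * s * (1 - (ρ / s) ^ d) + 2 * (ρ - s)) s := fun s hs => by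
    refine ((profile_hasDerivAt hd ρ (ht.trans_le hs.1)).fun_sub
      (((hasDerivAt_id' s).const_sub ρ).fun_pow 2)).congr_deriv ?_
    norm_num
  have h := antitoneOn_of_deriv_nonpos (convex_Icc t ρ)
    (fun s hs => (hder s hs).continuousAt.continuousWithinAt)
    (fun s hs => (hder s (interior_subset hs)).differentiableAt.differentiableWithinAt)
    (fun s hs => by
      have hs' := interior_subset hs
      have hs0 : 0 < s := ht.trans_le hs'.1
      rw [(hder s hs').deriv]
      have h2 : 1 ≤ ρ / s := (one_le_div hs0).2 hs'.2
      have h3 : ρ / s ≤ (ρ / s) ^ d := le_self_pow₀ h2 hd.ne'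
      have h4 : 2 * s * (1 - (ρ / s) ^ d) ≤ 2 * s * (1 - ρ / s) := by gcongr
      have h5 : 2 * s * (1 - ρ / s) = -(2 * (ρ - s)) := by field_simp; ring
      linarith) ⟨le_rfl, h1⟩ ⟨h1, le_rfl⟩ h1
  simp only [sub_self] at h
  linarith

/-- The drop from t to 2t alone is this large. Near the origin the Green function error, of order
(ρ/t)^d, is unbounded in ρ, so growth at the same rate is needed to beat it. -/
theorem profile_ge_of_small (hd : 0 < d) {ρ t : ℝ} (ht : 0 < t) (h1 : t ≤ ρ / 4) :
    t ^ 2 * ((ρ / t) ^ d / 2 ^ d) ≤ profile d ρ t - profile d ρ ρ := by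
  have hA := profile_ge_of_le hd (t := 2 * t) (ρ := ρ) (by positivity) (by linarith)
  have hA' : profile d ρ ρ ≤ profile d ρ (2 * t) := by linarith [sq_nonneg (ρ - 2 * t)]
  have hder : ∀ s ∈ Set.Icc t (2 * t),
      HasDerivAt (profile d ρ) (2 * s * (1 - (ρ / s) ^ d)) s :=
    fun s hs => profile_hasDerivAt hd ρ (ht.trans_le hs.1)
  have h2 : 2 ≤ ρ / (2 * t) := by rw [le_div_iff₀ (by positivity)]; linarith
  have h3 : 2 ≤ (ρ / (2 * t)) ^ d := h2.trans (le_self_pow₀ (by linarith) hd.ne')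
  have h := Convex.image_sub_le_mul_sub_of_deriv_le (convex_Icc t (2 * t)) (f := profile d ρ)
    (C := -(t * (ρ / (2 * t)) ^ d)) (fun s hs => (hder s hs).continuousAt.continuousWithinAt)
    (fun s hs => (hder s (interior_subset hs)).differentiableAt.differentiableWithinAt)
    (fun s hs => by
      have hs' := interior_subset hs
      have hs0 : 0 < s := ht.trans_le hs'.1
      rw [(hder s hs').deriv]
      have h4 : (ρ / (2 * t)) ^ d ≤ (ρ / s) ^ d := by
        have := hs'.2
        have : 0 ≤ ρ := by linarith
        gcongr
      have h5 : (ρ / (2 * t)) ^ d / 2 ≤ (ρ / s) ^ d - 1 := by linarith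
      have h6 : 2 * t * ((ρ / (2 * t)) ^ d / 2) ≤ 2 * s * ((ρ / s) ^ d - 1) := by
        have := hs'.1
        gcongr
      linarith)
    t ⟨le_rfl, by linarith⟩ (2 * t) ⟨by linarith, le_rfl⟩ (by linarith)
  have h7 : (ρ / (2 * t)) ^ d = (ρ / t) ^ d / 2 ^ d := by
    rw [← div_pow]; congr 1; field_simp
  rw [h7] at h
  nlinarith

/-- A function with Laplacian `1 - ω_d ρ ^ d δ₀` which is nearly nonnegative, bounded near the
sphere of radius `ρ` and large well inside of it. -/
theorem exists_obstacle (hd : 2 ≤ d) : ∃ C c : ℝ, 0 ≤ C ∧ 0 ≤ c ∧ ∀ ρ : ℝ, 1 ≤ ρ →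
    ∃ H : Lattice d → ℝ,
      (∀ x, lap H x = 1 - pointMass d (unitBallVolume d * ρ ^ d) x) ∧
      (∀ x, -C ≤ H x) ∧
      (∀ x, ρ ≤ euclNorm x → euclNorm x ≤ ρ + 2 → H x ≤ C) ∧
      (∀ x, euclNorm x < ρ - c → C < H x) := by
  have hd0 : 0 < d := by omega
  obtain ⟨K, hK, hgreen⟩ := exists_green_sub_potential_le hd0
  have hω := unitBallVolume_pos hd0
  set ω := unitBallVolume d with hωdef
  let E := K * ω
  have hE : 0 ≤ E := by positivity
  -- For R₀ ≤ |x| ≤ ρ/4 the Green function error is at most half of the bound in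
  -- `profile_ge_of_small`.
  let R₀ : ℝ := 2 ^ (d + 1) * E + 1
  have hR₀ : 1 ≤ R₀ := by
    have : 0 ≤ 2 ^ (d + 1) * E := by positivity
    simp only [R₀]; linarith
  have hR₀sq : 2 ^ (d + 1) * E ≤ R₀ ^ 2 := by
    have : 2 ^ (d + 1) * E ≤ R₀ := by simp only [R₀]; linarith
    nlinarith
  -- The terms pay for the growth of the profile across the layer, the Green function error for |x|
  -- ≥ ρ/4, and the loss inside radius R₀.
  let C : ℝ := 8 * d + E * 4 ^ d + (R₀ + 1) ^ 2
  have hC : 0 ≤ C := by positivity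
  let X : ℝ := 2 ^ (d + 1) * (C + E * 4 ^ d + (R₀ + 1) ^ 2)
  have hX : 0 ≤ X := by positivity
  -- The first term ensures R₀ + 1 ≤ ρ/4; the rest makes (ρ - |x|)² exceed `X`.
  refine ⟨C, 4 * (R₀ + 1) + X + 1, hC, by positivity, fun ρ hρ => ?_⟩
  have hρ0 : 0 < ρ := by linarith
  let H : Lattice d → ℝ := fun x =>
    euclNorm (x - 0) ^ 2 + (ω * ρ ^ d) * green x - profile d ρ ρ
  have hlap : ∀ x, lap H x = 1 - pointMass d (ω * ρ ^ d) x := by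
    intro x
    have h1 := lap_sub (fun x : Lattice d => euclNorm (x - 0) ^ 2 + (ω * ρ ^ d) * green x)
      (fun _ => profile d ρ ρ) x
    rw [lap_add, lap_const_mul, lap_const hd0, lap_euclNorm_sq hd0, lap_green hd0] at h1
    refine h1.trans ?_
    unfold pointMass
    split_ifs <;> ring
  have hH : ∀ x : Lattice d, x ≠ 0 →
      |H x - (profile d ρ (euclNorm x) - profile d ρ ρ)| ≤ E * (ρ / euclNorm x) ^ d := by
    intro x hx
    have h1 : H x - (profile d ρ (euclNorm x) - profile d ρ ρ) =
        (ω * ρ ^ d) * (green x - potential d (euclNorm x)) := by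
      simp only [H, profile, sub_zero, ← hωdef]; ring
    rw [h1, abs_mul, abs_of_nonneg (by positivity), div_pow]
    calc _ ≤ ω * ρ ^ d * (K * (euclNorm x ^ d)⁻¹) := by gcongr; exact hgreen x hx
      _ = _ := by simp only [E]; ring
  have hne : ∀ x : Lattice d, 0 < euclNorm x → x ≠ 0 := by
    rintro x hx rfl
    simp [euclNorm] at hx
  have hfar : ∀ x : Lattice d, ρ ≤ euclNorm x → E * (ρ / euclNorm x) ^ d ≤ E := fun x hx =>
    mul_le_of_le_one_right hE (pow_le_one₀ (by have := euclNorm_nonneg x; positivity)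
      ((div_le_one (by linarith)).2 hx))
  have hE4 : E ≤ E * 4 ^ d := le_mul_of_one_le_right hE (one_le_pow₀ (by norm_num))
  have hmid : ∀ x : Lattice d, ρ / 4 ≤ euclNorm x → euclNorm x ≤ ρ →
      (ρ - euclNorm x) ^ 2 - E * 4 ^ d ≤ H x := by
    intro x h1 h2
    have hpos : 0 < euclNorm x := by linarith
    have h3 := profile_ge_of_le hd0 hpos h2
    have h4 := (abs_le.1 (hH x (hne x hpos))).1
    have h5 : E * (ρ / euclNorm x) ^ d ≤ E * 4 ^ d := by
      gcongr
      rw [div_le_iff₀ hpos]; linarith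
    linarith
  have hnear : ∀ x : Lattice d, R₀ ≤ euclNorm x → euclNorm x ≤ ρ / 4 →
      ρ ^ 2 / 2 ^ (d + 1) ≤ H x := by
    intro x h1 h2
    have hpos : 0 < euclNorm x := by linarith
    have h3 := profile_ge_of_small hd0 hpos h2
    have h4 := (abs_le.1 (hH x (hne x hpos))).1
    set R := euclNorm x
    have h5 : E ≤ R ^ 2 / 2 ^ (d + 1) := by
      rw [le_div_iff₀ (by positivity)]
      have : R₀ ^ 2 ≤ R ^ 2 := by gcongr
      linarith
    have h6 : (ρ / R) ^ 2 ≤ (ρ / R) ^ d :=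
      pow_le_pow_right₀ ((one_le_div hpos).2 (by linarith)) hd
    calc ρ ^ 2 / 2 ^ (d + 1) = R ^ 2 / 2 ^ (d + 1) * (ρ / R) ^ 2 := by
          rw [div_pow]; field_simp
      _ ≤ R ^ 2 / 2 ^ (d + 1) * (ρ / R) ^ d := by gcongr
      _ = R ^ 2 * ((ρ / R) ^ d / 2 ^ d) - R ^ 2 / 2 ^ (d + 1) * (ρ / R) ^ d := by
          rw [pow_succ]; field_simp; ring
      _ ≤ R ^ 2 * ((ρ / R) ^ d / 2 ^ d) - E * (ρ / R) ^ d := by gcongr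
      _ ≤ H x := by linarith
  have hlow : ∀ x : Lattice d, R₀ ≤ euclNorm x → -(E * 4 ^ d) ≤ H x := by
    intro x h1
    rcases le_total (euclNorm x) (ρ / 4) with h2 | h2
    · have := hnear x h1 h2
      have h3 : 0 ≤ ρ ^ 2 / 2 ^ (d + 1) := by positivity
      have h4 : 0 ≤ E * 4 ^ d := by positivity
      linarith
    · rcases le_total (euclNorm x) ρ with h3 | h3
      · have := hmid x h2 h3
        linarith [sq_nonneg (ρ - euclNorm x)]
      · have h4 := profile_ge_of_ge hd0 hρ0 h3
        have h5 := (abs_le.1 (hH x (hne x (by linarith)))).1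
        linarith [hfar x h3]
  -- Inside radius R₀ the asymptotics say nothing useful, but H - |y|² is superharmonic, so a lower
  -- bound on the surrounding shell carries over at a cost of (R₀ + 1)².
  have hball : ∀ m : ℝ, (∀ y : Lattice d, R₀ ≤ euclNorm y → euclNorm y ≤ R₀ + 1 → m ≤ H y) →
      ∀ x : Lattice d, euclNorm x < R₀ → m - (R₀ + 1) ^ 2 ≤ H x := by
    intro m hm x hx
    have h1 := ge_of_superharmonic hd0 (finite_euclNorm_lt (0 : Lattice d) R₀)
      (v := fun y => H y - euclNorm (y - 0) ^ 2) (M := m - (R₀ + 1) ^ 2)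
      (fun y _ => by
        have hp : 0 ≤ pointMass d (ω * ρ ^ d) y := by
          unfold pointMass; split_ifs <;> positivity
        rw [lap_sub, lap_euclNorm_sq hd0, hlap]
        linarith)
      (fun y hy z hz hyz => by
        have h2 : euclNorm y < R₀ := by simpa using hy
        have h3 : R₀ ≤ euclNorm z := by simpa using hz
        have h4 := hyz.euclNorm_le
        have h5 := hm z h3 (by linarith)
        have h6 : euclNorm z ^ 2 ≤ (R₀ + 1) ^ 2 := by
          have := euclNorm_nonneg z
          gcongr; linarith
        simp only [sub_zero]
        linarith) x (by simpa using hx)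
    linarith [sq_nonneg (euclNorm (x - 0))]
  refine ⟨H, hlap, fun x => ?_, fun x h1 h2 => ?_, fun x hx => ?_⟩
  · have h8 : (0 : ℝ) ≤ 8 * d := by positivity
    rcases lt_or_ge (euclNorm x) R₀ with h | h
    · have := hball _ (fun y hy _ => hlow y hy) x h
      simp only [C]; linarith
    · have := hlow x h
      simp only [C]; linarith [sq_nonneg (R₀ + 1)]
  · have h3 := profile_sub_le hd0 hρ0 h1 h2
    have h4 := (abs_le.1 (hH x (hne x (by linarith)))).2
    have h5 := hfar x h1
    simp only [C]; linarith [sq_nonneg (R₀ + 1)]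
  · have hx0 := euclNorm_nonneg x
    have hc : X < (ρ - euclNorm x) ^ 2 := by nlinarith
    have hρc : X < ρ ^ 2 := by nlinarith
    have h2pow : (1 : ℝ) ≤ 2 ^ (d + 1) := one_le_pow₀ (by norm_num)
    have hE4' : 0 ≤ E * 4 ^ d := by positivity
    have hXC : C + E * 4 ^ d + (R₀ + 1) ^ 2 ≤ X := le_mul_of_one_le_left (by positivity) h2pow
    have hρX : C + E * 4 ^ d + (R₀ + 1) ^ 2 < ρ ^ 2 / 2 ^ (d + 1) := by
      rw [lt_div_iff₀ (by positivity)]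
      linarith
    rcases lt_or_ge (euclNorm x) R₀ with h | h
    · have := hball _ (fun y hy hy' => hnear y hy (by linarith)) x h
      linarith
    · rcases le_total (euclNorm x) (ρ / 4) with h' | h'
      · have := hnear x h h'
        linarith [sq_nonneg (R₀ + 1)]
      · have := hmid x h' (by linarith)
        linarith [sq_nonneg (R₀ + 1)]

end DivisibleSandpile

end

/-! ### The inner and outer bounds. -/

open DivisibleSandpile in
theorem theorem1p4 (d : ℕ) (hd : 2 ≤ d) :
    ∃ c c' : ℝ, ∀ m : ℝ, 0 ≤ m →
      ∃ ν : DivisibleSandpile.Lattice d → ℝ,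
        DivisibleSandpile.IsLimitingMass (DivisibleSandpile.pointMass d m) ν ∧
        DivisibleSandpile.latticeBall d
            ((m / DivisibleSandpile.unitBallVolume d) ^ (1 / (d : ℝ)) - c)
          ⊆ DivisibleSandpile.fullyOccupied ν ∧
        DivisibleSandpile.fullyOccupied ν
          ⊆ DivisibleSandpile.latticeBall d
            ((m / DivisibleSandpile.unitBallVolume d) ^ (1 / (d : ℝ)) + c') := by
  have hd0 : 0 < d := by omega
  obtain ⟨C, c, hC, hc, hobs⟩ := exists_obstacle hd
  have hω := unitBallVolume_pos hd0
  -- The extra 1 forces r ≥ 1 as soon as the inner ball is nonempty. The 2C + 5 keeps a ball of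
  -- radius 2C + 1 around x₀, with its neighbours, outside radius ρ + 1.
  refine ⟨c + 1, 2 * C + 5, fun m hm => ?_⟩
  set r := (m / unitBallVolume d) ^ (1 / (d : ℝ)) with hr
  have hr0 : 0 ≤ r := by positivity
  have hrd : unitBallVolume d * r ^ d = m := by
    rw [hr, one_div, Real.rpow_inv_natCast_pow (by positivity) hd0.ne']
    field_simp
  -- The obstacle exists only for radii at least 1; enlarging its source still gives a
  -- supersolution.
  let ρ := max r 1
  have hρ : 1 ≤ ρ := le_max_right _ _
  have hrρ : r ≤ ρ := le_max_left _ _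
  have hρr : ρ ≤ r + 1 := max_le (by linarith) (by linarith)
  obtain ⟨H, hlap, hlow, hlayer, hin⟩ := hobs ρ hρ
  have hmM : m ≤ unitBallVolume d * ρ ^ d := by
    rw [← hrd]; gcongr
  have hpm0 : ∀ x : Lattice d, 0 ≤ pointMass d m x := by
    intro x; unfold pointMass; split_ifs <;> simp [hm]
  have hw : ∀ x : Lattice d, pointMass d m x + lap (fun y => H y + C) x ≤ 1 := by
    intro x
    rw [lap_add, lap_const hd0, hlap]
    unfold pointMass
    split_ifs <;> linarith
  obtain ⟨u, hu0, huw, hu1, hufull, hlim, T, hT⟩ :=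
    exists_odometer_limit (fun x => by linarith [hlow x]) hw
  have hne : ∀ x : Lattice d, 0 < euclNorm x → x ≠ 0 := by
    rintro x hx rfl
    simp [euclNorm] at hx
  have houter : ∀ y : Lattice d, ρ + 1 < euclNorm y → u y ≤ 2 * C := by
    intro y hy
    refine le_of_tendsto' (hT y) fun n => ?_
    by_cases hy0 : odometer (pointMass d m) T n y = 0
    · rw [hy0]; positivity
    -- Finite-time odometers have finite support, so the maximum principle applies in the unbounded
    -- exterior. Off the origin their Laplacian is the current mass, which is nonnegative.
    refine le_of_subharmonic hd0
      (S := {x | ρ + 1 < euclNorm x ∧ odometer (pointMass d m) T n x ≠ 0})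
      ((odometer_finite (pointMass d m) T n).subset fun x hx => hx.2)
      (fun x hx => ?_) (fun x hx z hz hxz => ?_) y ⟨hy, hy0⟩
    · have h1 := massAt_eq (pointMass d m) T n x
      have h2 := massAt_nonneg hpm0 T n x
      have h3 : pointMass d m x = 0 := if_neg (hne x (by linarith [hx.1]))
      linarith
    · by_cases hz0 : odometer (pointMass d m) T n z = 0
      · rw [hz0]; positivity
      · have h1 : euclNorm z ≤ ρ + 1 := by
          by_contra! h
          exact hz ⟨h, hz0⟩
        have h2 := hxz.symm.euclNorm_le
        have h3 := hlayer z (by linarith [hx.1]) (by linarith)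
        have h4 := odometer_le (fun x => by linarith [hlow x]) hw T n z
        linarith
  refine ⟨fun x => pointMass d m x + lap u x, hlim, fun x hx => ?_, fun x₀ hx₀ => ?_⟩
  · have hx' : euclNorm x < r - (c + 1) := hx
    have hr1 : 1 ≤ r := by linarith [euclNorm_nonneg x]
    have hρeq : ρ = r := max_eq_left hr1
    rw [hρeq] at hlap hlayer hin
    rw [hrd] at hlap
    refine hufull x ?_
    have h1 := ge_of_superharmonic hd0 (finite_euclNorm_lt (0 : Lattice d) r)
      (v := fun y => u y - H y) (M := -C)
      (fun y _ => by rw [lap_sub, hlap]; linarith [hu1 y])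
      (fun y hy z hz hyz => by
        have h2 : euclNorm y < r := by simpa using hy
        have h3 : r ≤ euclNorm z := by simpa using hz
        have h4 := hlayer z h3 (by linarith [hyz.euclNorm_le])
        linarith [hu0 z]) x (by simp; linarith)
    linarith [hin x (by linarith)]
  · have hx₁ : pointMass d m x₀ + lap u x₀ = 1 := hx₀
    by_contra hcon
    have hfar : r + (2 * C + 5) ≤ euclNorm x₀ := not_lt.1 hcon
    have hball : ∀ y : Lattice d, euclNorm x₀ ≤ euclNorm y + euclNorm (y - x₀) := by
      intro y
      have h1 := euclNorm_add_le y (-(y - x₀))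
      rwa [euclNorm_neg, neg_sub, add_sub_cancel] at h1
    -- Where u ≥ |y - x₀|², the site y is full: by assumption if y = x₀, and otherwise because u ≥ 1
    -- > 0. Hence Δu = 1 there. On the boundary, 2C < (2C + 1)².
    have h1 := lt_of_subharmonic hd0 (finite_euclNorm_lt x₀ (2 * C + 1))
      (v := fun y => u y - euclNorm (y - x₀) ^ 2) (M := 0)
      (fun y hy hv => by
        have hy' : euclNorm (y - x₀) < 2 * C + 1 := hy
        have hy0 : pointMass d m y = 0 := if_neg (hne y (by linarith [hball y]))
        rw [lap_sub, lap_euclNorm_sq hd0]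
        by_cases hyx : y = x₀
        · rw [hyx] at hy0 ⊢; linarith
        · have h2 := one_le_euclNorm (sub_ne_zero.2 hyx)
          have := hufull y (by nlinarith)
          linarith)
      (fun y hy z hz hyz => by
        have hy' : euclNorm (y - x₀) < 2 * C + 1 := hy
        have hz' : 2 * C + 1 ≤ euclNorm (z - x₀) := not_lt.1 hz
        have h2 := hyz.euclNorm_sub_le x₀
        have h3 := houter z (by linarith [hball z])
        nlinarith) x₀ (by
          have : (0 : ℝ) < 2 * C + 1 := by positivity
          simpa [euclNorm] using this)
    have h0 : euclNorm (x₀ - x₀) = 0 := by simp [euclNorm]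
    simp only [h0] at h1
    linarith [hu0 x₀]
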